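/- For a positive integer $n$ let $E_n=\{x_i=1,\ x_i+x_j=x_k,\ x_i\cdot x_j=x_k:\ i,j,k\in\{1,\ldots,n\}\}$. **Conjecture.** For every positive integer $n$: if a system $S\subseteq E_n$ has only finitely many solutions in integers $x_1,\ldots,x_n$, then each such solution satisfies $|x_1|,\ldots,|x_n|\le 2^{2^{n-1}}$. We say that the Conjecture is false for $n$ if the assertion after the colon fails for this $n$. Consider the following MuPAD code, executed with unlimited memory and integers of arbitrary size (lists are indexed from $1$; nops is the length of a list; in max(e $\$$t=a..b) the variable t is local; and/or are evaluated lazily). \begin{verbatim} X:=[-5,-5]: while 0=0 do n:=nops(X): t:=0: for t1 from 1 to n do for t2 from t1 to n do for t3 from 1 to n do if X[t1]+X[t2]=X[t3] then t:=t+1 end_if: if X[t1]*X[t2]=X[t3] then t:=t+1 end_if: end_for: end_for: end_for: if t>0 then print(X) end_if: B:=[]: for t from 1 to n do B:=append(B,-max(abs(X[t]) $t=1..n)-1): end_for: repeat m:=0: S:=[1,1,1]: repeat if (X[S[1]]+X[S[2]]=X[S[3]] and B[S[1]]+B[S[2]]<>B[S[3]]) then m:=1 end_if: if (X[S[1]]*X[S[2]]=X[S[3]]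 and B[S[1]]*B[S[2]]<>B[S[3]]) then m:=1 end_if: i:=1: while (i<=3 and S[i]=n) do i:=i+1: end_while: if i=1 then S[1]:=S[1]+1 end_if: if i=2 then S[1]:=S[2]+1: S[2]:=S[2]+1: end_if: if (i=3 or i=4) then S[1]:=1: S[2]:=1: S[3]:=S[3]+1: end_if: until (S[3]=n+1 or m=1) end_repeat: Y:=B: b:=max(abs(B[t]) $t=1..n): w:=max(abs(B[t]) $t=2..n): q:=1: while (q<=n and B[q]=b) do q:=q+1: end_while: if (q=1 and w<b) then B[1]:=b end_if: if (q=1 and w=b) then B[1]:=B[1]+1 end_if: if (q>1 and q<=n) then for u from 1 to q-1 do B[u]:=-b: end_for: B[q]:=B[q]+1: end_if: if q=n+1 then B:=[]: for t from 1 to n do B:=append(B,-b-1): end_for: end_if: until m=0 end_repeat: t:=0: for t1 from 1 to n do for t2 from t1 to n do for t3 from 1 to n do if X[t1]+X[t2]=X[t3] then t:=t+1 end_if: if X[t1]*X[t2]=X[t3] then t:=t+1 end_if: end_for: end_for: end_for: if t>0 then print([X,Y]) end_if: b:=max(abs(X[t]) $t=1..n): w:=max(abs(X[t]) $t=2..n):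 q:=1: while (q<=n and X[q]=b) do q:=q+1: end_while: if (q=1 and w<b) then X[1]:=b end_if: if (q=1 and w=b) then X[1]:=X[1]+1 end_if: if (q>1 and q<=n) then for u from 1 to q-1 do X[u]:=-b: end_for: X[q]:=X[q]+1: end_if: if q=n+1 then X:=[]: for t from 1 to n do X:=append(X,-b-1): end_for: end_if: if max(abs(X[t]) $t=1..n)>2^(2^n) then print(n): X:=[]: for t from 1 to n+1 do X:=append(X,-1-2^(2^n)): end_for: end_if: end_while: \end{verbatim} **Theorem.** The execution of the code never terminates (neither regularly nor with an error). If the Conjecture is true, then the integers displayed by the code are, in this order, $2,3,4,\ldots$, i.e. all integers $n\ge 2$. If the Conjecture is false, then there is an integer $n\ge 4$ such that the integers displayed by the code are, in this order, exactly $2,\ldots,n-1$, and the Conjecture is false for all integers $m\ge n$. (Besides integers, the code also displays lists of integers and pairs of such lists; these are disregarded here.) -/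

import Mathlib

/-! ### The Conjecture -/

/-- The equations `x_i = 1`, `x_i + x_j = x_k`, `x_i * x_j = x_k` in the unknowns
`x_1, …, x_n` (indexed by `Fin n`). The type `Equation n` is the set `E_n`. -/
inductive Equation (n : ℕ) : Type
  | one (i : Fin n) : Equation n
  | add (i j k : Fin n) : Equation n
  | mul (i j k : Fin n) : Equation n

/-- The integer tuple `x` satisfies the given equation. -/
def Equation.Holds {n : ℕ} (x : Fin n → ℤ) : Equation n → Prop
  | .one i => x i = 1
  | .add i j k => x i + x j = x k
  | .mul i j k => x i * x j = x k

/-- The set of integer solutions of a system `S ⊆ E_n`. -/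
def solutions {n : ℕ} (S : Set (Equation n)) : Set (Fin n → ℤ) :=
  {x | ∀ e ∈ S, e.Holds x}

/-- The Conjecture for a fixed number `n` of unknowns. -/
def ConjectureFor (n : ℕ) : Prop :=
  ∀ S : Set (Equation n), (solutions S).Finite →
    ∀ x ∈ solutions S, ∀ i : Fin n, |x i| ≤ 2 ^ (2 ^ (n - 1))

/-- The Conjecture. -/
def Conjecture : Prop := ∀ n : ℕ, 1 ≤ n → ConjectureFor n

/-! ### A fragment of the MuPAD language

Integers have arbitrary precision. Variables are split according to the kind of their values:
integers, and lists of integers with positions numbered from `1`. The evaluation of an expression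
fails (value `none`) in case of an error, and then the execution stops. -/

namespace MuPAD

/-- The variables of the code that have integer values. -/
inductive IntVar : Type
  | n | t | t1 | t2 | t3 | m | i | b | w | q | u
  deriving DecidableEq

/-- The variables of the code whose values are lists of integers. -/
inductive ListVar : Type
  | X | B | S | Y
  deriving DecidableEq

/-- The current values of all variables. -/
structure Store : Type where
  int : IntVar → ℤ
  list : ListVar → List ℤ

/-- The store after the assignment `x := z`. -/
def Store.setInt (s : Store) (x : IntVar) (z : ℤ) : Store :=
  { s with int := Function.update s.int x z }

/-- The store after the assignment `L := l`. -/
def Store.setList (s : Store) (L : ListVar) (l : List ℤ) : Store :=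
  { s with list := Function.update s.list L l }

/-- `position l z` is the index, counted from `0`, of the entry that MuPAD denotes by `l[z]`,
provided that `1 ≤ z ≤ nops(l)`. -/
def position (l : List ℤ) (z : ℤ) : Option ℕ :=
  if 1 ≤ z ∧ z ≤ l.length then some (z - 1).toNat else none

/-- Expressions with integer values. -/
inductive IntExpr : Type
  /-- an integer literal -/
  | lit (z : ℤ) : IntExpr
  /-- the value of a variable -/
  | var (x : IntVar) : IntExpr
  | add (a b : IntExpr) : IntExpr
  | sub (a b : IntExpr) : IntExpr
  | mul (a b : IntExpr) : IntExpr
  | neg (a : IntExpr) : IntExpr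
  /-- `a^b` -/
  | pow (a b : IntExpr) : IntExpr
  /-- `abs(a)` -/
  | abs (a : IntExpr) : IntExpr
  /-- `nops(L)`, the length of a list -/
  | nops (L : ListVar) : IntExpr
  /-- `L[a]` -/
  | get (L : ListVar) (a : IntExpr) : IntExpr
  /-- `max(e $ x=a..b)`, where `x` is bound in `e` -/
  | maxSeq (e : IntExpr) (x : IntVar) (a b : IntExpr) : IntExpr

instance (k : ℕ) : OfNat IntExpr k := ⟨.lit k⟩
instance : Add IntExpr := ⟨.add⟩
instance : Sub IntExpr := ⟨.sub⟩
instance : Mul IntExpr := ⟨.mul⟩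
instance : Neg IntExpr := ⟨.neg⟩
instance : Coe IntVar IntExpr := ⟨.var⟩

/-- The value of an integer expression. -/
def IntExpr.eval : IntExpr → Store → Option ℤ
  | .lit z, _ => some z
  | .var x, s => some (s.int x)
  | .add a b, s => do return (← a.eval s) + (← b.eval s)
  | .sub a b, s => do return (← a.eval s) - (← b.eval s)
  | .mul a b, s => do return (← a.eval s) * (← b.eval s)
  | .neg a, s => do return -(← a.eval s)
  | .pow a b, s => do
      let z ← a.eval s
      let e ← b.eval s
      if 0 ≤ e then some (z ^ e.toNat) else none
  | .abs a, s => do return |← a.eval s|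
  | .nops L, s => some (s.list L).length
  | .get L a, s => do
      let p ← position (s.list L) (← a.eval s)
      (s.list L)[p]?
  | .maxSeq e x a b, s => do
      let lo ← a.eval s
      let hi ← b.eval s
      let vals ← (List.range (hi + 1 - lo).toNat).mapM fun k =>
        e.eval (s.setInt x (lo + k))
      vals.max?

/-- Boolean expressions. -/
inductive BoolExpr : Type
  | eq (a b : IntExpr) : BoolExpr
  | ne (a b : IntExpr) : BoolExpr
  | lt (a b : IntExpr) : BoolExpr
  | le (a b : IntExpr) : BoolExpr
  | not (c : BoolExpr) : BoolExpr
  | and (c d : BoolExpr) : BoolExpr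
  | or (c d : BoolExpr) : BoolExpr

/-- The value of a Boolean expression. As always in the conditions of MuPAD statements, the second
argument of `and`, `or` is evaluated only if the first one does not decide the result. -/
def BoolExpr.eval : BoolExpr → Store → Option Bool
  | .eq a b, s => do return decide ((← a.eval s) = (← b.eval s))
  | .ne a b, s => do return decide ((← a.eval s) ≠ (← b.eval s))
  | .lt a b, s => do return decide ((← a.eval s) < (← b.eval s))
  | .le a b, s => do return decide ((← a.eval s) ≤ (← b.eval s))
  | .not c, s => do return !(← c.eval s)
  | .and c d, s => do if ← c.eval s then d.eval s else return false
  | .or c d, s => do if ← c.eval s then return true else d.eval s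

/-- Expressions whose values are lists of integers. -/
inductive ListExpr : Type
  /-- the value of a variable -/
  | var (L : ListVar) : ListExpr
  /-- `[e₁, …, eₖ]` -/
  | lit (es : List IntExpr) : ListExpr
  /-- `append(l, e)` -/
  | append (l : ListExpr) (e : IntExpr) : ListExpr

instance : Coe ListVar ListExpr := ⟨.var⟩

/-- The value of a list expression. -/
def ListExpr.eval : ListExpr → Store → Option (List ℤ)
  | .var L, s => some (s.list L)
  | .lit es, s => es.mapM fun e => e.eval s
  | .append l e, s => do return (← l.eval s) ++ [← e.eval s]

/-- Statements. -/
inductive Stmt : Type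
  /-- `x:=e` -/
  | assign (x : IntVar) (e : IntExpr) : Stmt
  /-- `L:=e` -/
  | assignList (L : ListVar) (e : ListExpr) : Stmt
  /-- `L[a]:=e` -/
  | assignEntry (L : ListVar) (a e : IntExpr) : Stmt
  /-- `print(e)` for an integer `e` -/
  | print (e : IntExpr) : Stmt
  /-- `print(e)` for a list `e` of integers -/
  | printList (e : ListExpr) : Stmt
  /-- `print([e, f])` for lists `e`, `f` of integers -/
  | printPair (e f : ListExpr) : Stmt
  /-- `if c then body end_if` -/
  | ifThen (c : BoolExpr) (body : List Stmt) : Stmt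
  /-- `while c do body end_while` -/
  | whileDo (c : BoolExpr) (body : List Stmt) : Stmt
  /-- `repeat body until c end_repeat` -/
  | repeatUntil (body : List Stmt) (c : BoolExpr) : Stmt
  /-- `for x from a to b do body end_for` -/
  | forDo (x : IntVar) (a b : IntExpr) (body : List Stmt) : Stmt

/-- The things that are displayed. -/
inductive Item : Type
  | int (z : ℤ) : Item
  | list (l : List ℤ) : Item
  | pair (l l' : List ℤ) : Item

/-- A state of an execution: the statements that remain to be executed, the values of the
variables, and what has been displayed so far, in chronological order. -/
structure State : Type where
  todo : List Stmt
  store : Store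
  output : List Item

/-- One step of an execution. The value is `none` if nothing remains to be executed
or if an error occurs. -/
def State.step : State → Option State
  | ⟨[], _, _⟩ => none
  | ⟨.assign x e :: K, s, o⟩ => do
      return ⟨K, s.setInt x (← e.eval s), o⟩
  | ⟨.assignList L e :: K, s, o⟩ => do
      return ⟨K, s.setList L (← e.eval s), o⟩
  | ⟨.assignEntry L a e :: K, s, o⟩ => do
      let p ← position (s.list L) (← a.eval s)
      return ⟨K, s.setList L ((s.list L).set p (← e.eval s)), o⟩
  | ⟨.print e :: K, s, o⟩ => do
      return ⟨K, s, o ++ [.int (← e.eval s)]⟩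
  | ⟨.printList e :: K, s, o⟩ => do
      return ⟨K, s, o ++ [.list (← e.eval s)]⟩
  | ⟨.printPair e f :: K, s, o⟩ => do
      return ⟨K, s, o ++ [.pair (← e.eval s) (← f.eval s)]⟩
  | ⟨.ifThen c body :: K, s, o⟩ => do
      return ⟨if ← c.eval s then body ++ K else K, s, o⟩
  | ⟨.whileDo c body :: K, s, o⟩ => do
      return ⟨if ← c.eval s then body ++ .whileDo c body :: K else K, s, o⟩
  | ⟨.repeatUntil body c :: K, s, o⟩ =>
      some ⟨body ++ .whileDo (.not c) body :: K, s, o⟩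
  | ⟨.forDo x a b body :: K, s, o⟩ => do
      let lo ← a.eval s
      let hi ← b.eval s
      return ⟨if lo ≤ hi then body ++ .forDo x (x + 1) (.lit hi) body :: K else K,
        s.setInt x lo, o⟩

/-- The state after `k` steps, if the execution lasts that long. -/
def State.after (c : State) : ℕ → Option State
  | 0 => some c
  | k + 1 => (c.after k).bind State.step

/-- The beginning of the execution of a code. -/
def start (code : List Stmt) (s : Store) : State := ⟨code, s, []⟩

/-- The execution of the code, started with the store `s`, never terminates, neither
regularly nor with an error. -/
def NeverTerminates (code : List Stmt) (s : Store) : Prop :=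
  ∀ k : ℕ, ∃ c : State, (start code s).after k = some c

/-- The integers in a list of displayed items; lists and pairs of lists are ignored. -/
def integersIn (o : List Item) : List ℤ :=
  o.filterMap fun
    | .int z => some z
    | _ => none

/-- In the execution of the code, started with the store `s`, at least `r + 1` integers are
displayed, and the one that is displayed after exactly `r` others is `z`. -/
def DisplaysInteger (code : List Stmt) (s : Store) (r : ℕ) (z : ℤ) : Prop :=
  ∃ (k : ℕ) (c : State), (start code s).after k = some c ∧ (integersIn c.output)[r]? = some z

/-! ### The code -/

open IntVar ListVar

/-- `max(abs(L[t]) $t=a..n)` -/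
def maxAbs (L : ListVar) (a : IntExpr) : IntExpr :=
  .maxSeq (.abs (.get L t)) t a n

/-- The lines
```
t:=0:
for t1 from 1 to n do
for t2 from t1 to n do
for t3 from 1 to n do
if X[t1]+X[t2]=X[t3] then t:=t+1 end_if:
if X[t1]*X[t2]=X[t3] then t:=t+1 end_if:
end_for:
end_for:
end_for:
``` -/
def countEquations : List Stmt :=
  [ .assign t 0,
    .forDo t1 1 n [
      .forDo t2 t1 n [
        .forDo t3 1 n [
          .ifThen (.eq (.get X t1 + .get X t2) (.get X t3)) [.assign t (t + 1)],
          .ifThen (.eq (.get X t1 * .get X t2) (.get X t3)) [.assign t (t + 1)]]]]]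

/-- The lines
```
b:=max(abs(L[t]) $t=1..n):
w:=max(abs(L[t]) $t=2..n):
q:=1:
while (q<=n and L[q]=b) do
q:=q+1:
end_while:
if (q=1 and w<b) then L[1]:=b end_if:
if (q=1 and w=b) then L[1]:=L[1]+1 end_if:
if (q>1 and q<=n) then
for u from 1 to q-1 do
L[u]:=-b:
end_for:
L[q]:=L[q]+1:
end_if:
if q=n+1 then
L:=[]:
for t from 1 to n do
L:=append(L,-b-1):
end_for:
end_if:
```
which occur in the code with `B` and with `X` in place of `L`. -/
def nextTuple (L : ListVar) : List Stmt :=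
  [ .assign b (maxAbs L 1),
    .assign w (maxAbs L 2),
    .assign q 1,
    .whileDo (.and (.le q n) (.eq (.get L q) b)) [
      .assign q (q + 1)],
    .ifThen (.and (.eq q 1) (.lt w b)) [.assignEntry L 1 b],
    .ifThen (.and (.eq q 1) (.eq w b)) [.assignEntry L 1 (.get L 1 + 1)],
    .ifThen (.and (.lt 1 q) (.le q n)) [
      .forDo u 1 (q - 1) [
        .assignEntry L u (-b)],
      .assignEntry L q (.get L q + 1)],
    .ifThen (.eq q (n + 1)) [
      .assignList L (.lit []),
      .forDo t 1 n [
        .assignList L (.append L (-b - 1))]]]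

/-- The loop
```
repeat
if (X[S[1]]+X[S[2]]=X[S[3]] and B[S[1]]+B[S[2]]<>B[S[3]])
then m:=1 end_if:
if (X[S[1]]*X[S[2]]=X[S[3]] and B[S[1]]*B[S[2]]<>B[S[3]])
then m:=1 end_if:
i:=1:
while (i<=3 and S[i]=n) do
i:=i+1:
end_while:
if i=1 then S[1]:=S[1]+1 end_if:
if i=2 then
S[1]:=S[2]+1:
S[2]:=S[2]+1:
end_if:
if (i=3 or i=4) then
S[1]:=1:
S[2]:=1:
S[3]:=S[3]+1:
end_if:
until (S[3]=n+1 or m=1) end_repeat: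
``` -/
def compareTuples : Stmt :=
  .repeatUntil [
    .ifThen (.and
        (.eq (.get X (.get S 1) + .get X (.get S 2)) (.get X (.get S 3)))
        (.ne (.get B (.get S 1) + .get B (.get S 2)) (.get B (.get S 3)))) [
      .assign m 1],
    .ifThen (.and
        (.eq (.get X (.get S 1) * .get X (.get S 2)) (.get X (.get S 3)))
        (.ne (.get B (.get S 1) * .get B (.get S 2)) (.get B (.get S 3)))) [
      .assign m 1],
    .assign i 1,
    .whileDo (.and (.le i 3) (.eq (.get S i) n)) [
      .assign i (i + 1)],
    .ifThen (.eq i 1) [.assignEntry S 1 (.get S 1 + 1)],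
    .ifThen (.eq i 2) [
      .assignEntry S 1 (.get S 2 + 1),
      .assignEntry S 2 (.get S 2 + 1)],
    .ifThen (.or (.eq i 3) (.eq i 4)) [
      .assignEntry S 1 1,
      .assignEntry S 2 1,
      .assignEntry S 3 (.get S 3 + 1)]]
  (.or (.eq (.get S 3) (n + 1)) (.eq m 1))

/-- The whole code:
```
X:=[-5,-5]:
while 0=0 do
n:=nops(X):
(count equations)
if t>0 then print(X) end_if:
B:=[]:
for t from 1 to n do
B:=append(B,-max(abs(X[t]) $t=1..n)-1):
end_for:
repeat
m:=0:
S:=[1,1,1]: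
(compare tuples)
Y:=B:
(next tuple, for B)
until m=0 end_repeat:
(count equations)
if t>0 then print([X,Y]) end_if:
(next tuple, for X)
if max(abs(X[t]) $t=1..n)>2^(2^n) then
print(n):
X:=[]:
for t from 1 to n+1 do
X:=append(X,-1-2^(2^n)):
end_for:
end_if:
end_while:
``` -/
def code : List Stmt :=
  [ .assignList X (.lit [-5, -5]),
    .whileDo (.eq 0 0) (
      [ .assign n (.nops X)] ++
      countEquations ++
      [ .ifThen (.lt 0 t) [.printList X],
        .assignList B (.lit []),
        .forDo t 1 n [
          .assignList B (.append B (-maxAbs X 1 - 1))],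
        .repeatUntil (
          [ .assign m 0,
            .assignList S (.lit [1, 1, 1]),
            compareTuples,
            .assignList Y B] ++
          nextTuple B)
        (.eq m 0)] ++
      countEquations ++
      [ .ifThen (.lt 0 t) [.printPair X Y]] ++
      nextTuple X ++
      [ .ifThen (.lt (.pow 2 (.pow 2 n)) (maxAbs X 1)) [
          .print n,
          .assignList X (.lit []),
          .forDo t 1 (n + 1) [
            .assignList X (.append X (-1 - .pow 2 (.pow 2 n)))]]])]

end MuPAD

namespace MuPAD

/-! ### Executions -/

/-! For each length `n ≥ 2` the program runs through the integer tuples `X` whose maximal absolute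
value lies in the window `2^(2^(n-1)) < max ≤ 2^(2^n)`. For each of them it searches for a tuple `B`
with a larger maximum that satisfies every additive and multiplicative equation valid for `X`
(`Extendable`). If all searches of one length succeed, `n` is displayed and the next length begins;
the first failing search runs forever. So the display depends only on the least `n` for which
`SearchSucceeds n` fails.

The link with the Conjecture consists of three facts. A non-extendable tuple in the window for `n`
refutes the Conjecture for `n`, since the equations valid for it have only solutions with no larger
maximum, hence finitely many (`ConjectureFor.searchSucceeds`). Conversely, a counterexample of
length `n` gives a failing search of some length `N ≥ n`: take a solution of largest maximum and pad
it with ones until the maximum fits the window; the ones stay ones in any larger tuple with the same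
equations (`exists_not_searchSucceeds`). Finally, a failure for `n` gives one for `n + 1` by
adjoining the square of a large entry (`ConjectureFor.of_succ`). Hence the Conjecture fails for
every `m` from the first failing length on. That length is at least `4`, because explicit families
extend all relevant pairs and triples (`exists_preserves_pair`, `exists_preservesTriple`).

The program is verified by a calculus of weakest preconditions for total correctness (`Wp`). Its
combinatorial core is that the enumeration `nextList` misses no tuple
(`iterate_nextList_replicate`). -/

/-- The execution leads from the state `c` to the state `d`. -/
def Reaches (c d : State) : Prop := ∃ k : ℕ, c.after k = some d

theorem State.after_add (c : State) (j k : ℕ) :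
    c.after (j + k) = (c.after j).bind fun d => d.after k := by
  induction k with
  | zero => cases h : c.after j <;> simp [State.after]
  | succ k ih =>
    rw [← add_assoc, State.after, ih]
    cases h : c.after j <;> simp [State.after]

theorem Reaches.refl (c : State) : Reaches c c := ⟨0, rfl⟩

theorem Reaches.trans {c d e : State} (h : Reaches c d) (h' : Reaches d e) : Reaches c e := by
  obtain ⟨j, hj⟩ := h
  obtain ⟨k, hk⟩ := h'
  exact ⟨j + k, by rw [State.after_add, hj]; exact hk⟩

theorem Reaches.of_step {c d : State} (h : c.step = some d) : Reaches c d :=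
  ⟨1, by simp [State.after, h]⟩

theorem Reaches.head {c d e : State} (h : c.step = some d) (h' : Reaches d e) : Reaches c e :=
  (Reaches.of_step h).trans h'

theorem integersIn_append (o o' : List Item) :
    integersIn (o ++ o') = integersIn o ++ integersIn o' := by
  simp [integersIn]

theorem State.step_output {c d : State} (h : c.step = some d) : c.output <+: d.output := by
  obtain ⟨todo, s, o⟩ := c
  rcases todo with _ | ⟨st, K⟩
  · simp [State.step] at h
  · cases st <;> simp only [State.step, Option.bind_eq_bind, Option.pure_def,
      Option.bind_eq_some_iff, Option.some.injEq] at h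
    case repeatUntil => subst h; exact List.prefix_refl _
    case forDo =>
      obtain ⟨_, _, _, _, h⟩ := h
      subst h; exact List.prefix_refl _
    case assignEntry =>
      obtain ⟨_, _, _, _, _, _, h⟩ := h
      subst h; exact List.prefix_refl _
    case printPair =>
      obtain ⟨_, _, _, _, h⟩ := h
      subst h
      simp
    all_goals
      obtain ⟨_, _, h⟩ := h
      subst h
      simp

theorem State.after_output {c d : State} {k : ℕ} (h : c.after k = some d) :
    c.output <+: d.output := by
  induction k generalizing d with
  | zero => simp only [State.after, Option.some.injEq] at h; rw [h]
  | succ k ih =>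
    rw [State.after, Option.bind_eq_some_iff] at h
    obtain ⟨e, he, hd⟩ := h
    exact (ih he).trans (State.step_output hd)

/-- Output is never erased, so the integer displayed at a given position can be read off from any
later state. -/
theorem State.after_integersIn {c d : State} {k : ℕ} (h : c.after k = some d) :
    integersIn c.output <+: integersIn d.output := by
  obtain ⟨t, ht⟩ := State.after_output h
  rw [← ht, integersIn_append]
  exact List.prefix_append _ _

theorem State.after_of_le {c d : State} {j k : ℕ} (h : c.after k = some d) (hjk : j ≤ k) :
    ∃ e, c.after j = some e ∧ e.after (k - j) = some d := by
  obtain ⟨i, rfl⟩ := Nat.exists_eq_add_of_le hjk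
  rw [State.after_add, Option.bind_eq_some_iff] at h
  simpa using h

/-- If every state with property `P` leads in at least one step to another state with
property `P`, then the execution never stops. -/
theorem State.after_of_recurrent {P : State → Prop}
    (hP : ∀ c, P c → ∃ k d, c.after (k + 1) = some d ∧ P d) {c : State} (hc : P c) (k : ℕ) :
    ∃ j d, k ≤ j ∧ c.after j = some d ∧ P d := by
  induction k with
  | zero => exact ⟨0, c, le_rfl, rfl, hc⟩
  | succ k ih =>
    obtain ⟨j, d, hj, hd, hPd⟩ := ih
    obtain ⟨i, e, he, hPe⟩ := hP d hPd
    exact ⟨j + (i + 1), e, by omega, by rw [State.after_add, hd]; exact he, hPe⟩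

/-! ### Weakest preconditions -/

/-- Executed with the store `s`, the statements `p` terminate without error and without displaying
integers, and then the store has property `Q`. -/
def Wp (p : List Stmt) (Q : Store → Prop) (s : Store) : Prop :=
  ∃ s', Q s' ∧ ∀ K o, ∃ o', integersIn o' = integersIn o ∧
    Reaches ⟨p ++ K, s, o⟩ ⟨K, s', o'⟩

theorem Wp.mono {p : List Stmt} {Q Q' : Store → Prop} {s : Store} (h : Wp p Q s)
    (hQ : ∀ s', Q s' → Q' s') : Wp p Q' s := by
  obtain ⟨s', h1, h2⟩ := h
  exact ⟨s', hQ s' h1, h2⟩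

theorem Wp.nil {Q : Store → Prop} {s : Store} (h : Q s) : Wp [] Q s :=
  ⟨s, h, fun _ o => ⟨o, rfl, .refl _⟩⟩

/-- Composition works because in `Wp` the final store is fixed before the continuation: the first
fragment is run with `p' ++ K` as the rest of the code. -/
theorem Wp.append {p p' : List Stmt} {Q : Store → Prop} {s : Store} (h : Wp p (Wp p' Q) s) :
    Wp (p ++ p') Q s := by
  obtain ⟨s', ⟨s'', hQ, h2⟩, h1⟩ := h
  refine ⟨s'', hQ, fun K o => ?_⟩
  obtain ⟨o', ho', hr⟩ := h1 (p' ++ K) o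
  obtain ⟨o'', ho'', hr'⟩ := h2 K o'
  exact ⟨o'', ho''.trans ho', by rw [List.append_assoc]; exact hr.trans hr'⟩

theorem Wp.cons {a : Stmt} {p : List Stmt} {Q : Store → Prop} {s : Store} (h : Wp [a] (Wp p Q) s) :
    Wp (a :: p) Q s :=
  Wp.append (p := [a]) h

theorem Wp.of_step {p p' : List Stmt} {Q : Store → Prop} {s s' : Store} {l : List Item}
    (hl : integersIn l = [])
    (h : ∀ K o, (State.mk (p ++ K) s o).step = some ⟨p' ++ K, s', o ++ l⟩) (h' : Wp p' Q s') :
    Wp p Q s := by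
  obtain ⟨s'', hQ, h2⟩ := h'
  refine ⟨s'', hQ, fun K o => ?_⟩
  obtain ⟨o', ho', hr⟩ := h2 K (o ++ l)
  refine ⟨o', ?_, Reaches.head (h K o) hr⟩
  rw [ho', integersIn_append, hl, List.append_nil]

section
variable {K body : List Stmt} {Q : Store → Prop} {s : Store}

theorem Wp.assign {x : IntVar} {e : IntExpr} {z : ℤ} (he : e.eval s = some z)
    (h : Wp K Q (s.setInt x z)) : Wp (.assign x e :: K) Q s :=
  Wp.of_step (l := []) rfl (fun K o => by simp [State.step, he]) h

theorem Wp.assignList {L : ListVar} {e : ListExpr} {l : List ℤ} (he : e.eval s = some l)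
    (h : Wp K Q (s.setList L l)) : Wp (.assignList L e :: K) Q s :=
  Wp.of_step (l := []) rfl (fun K o => by simp [State.step, he]) h

theorem Wp.assignEntry {L : ListVar} {a e : IntExpr} {z y : ℤ} (ha : a.eval s = some z)
    (hz : 1 ≤ z) (hz' : z ≤ (s.list L).length) (he : e.eval s = some y)
    (h : Wp K Q (s.setList L ((s.list L).set (z - 1).toNat y))) :
    Wp (.assignEntry L a e :: K) Q s :=
  Wp.of_step (l := []) rfl (fun K o => by simp [State.step, he, ha, position, hz, hz']) h

theorem Wp.printList {e : ListExpr} {l : List ℤ} (he : e.eval s = some l)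
    (h : Wp K Q s) : Wp (.printList e :: K) Q s :=
  Wp.of_step (l := [.list l]) rfl (fun K o => by simp [State.step, he]) h

theorem Wp.printPair {e f : ListExpr} {l l' : List ℤ} (he : e.eval s = some l)
    (hf : f.eval s = some l') (h : Wp K Q s) : Wp (.printPair e f :: K) Q s :=
  Wp.of_step (l := [.pair l l']) rfl (fun K o => by simp [State.step, he, hf]) h

theorem Wp.ifThen {c : BoolExpr} {v : Bool} (hc : c.eval s = some v)
    (ht : v = true → Wp body (Wp K Q) s) (hf : v = false → Wp K Q s) :
    Wp (.ifThen c body :: K) Q s := by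
  cases v with
  | true =>
    exact Wp.of_step (l := []) rfl (fun K o => by simp [State.step, hc]) (Wp.append (ht rfl))
  | false => exact Wp.of_step (l := []) rfl (fun K o => by simp [State.step, hc]) (hf rfl)

theorem Wp.whileDo_true {c : BoolExpr} (hc : c.eval s = some true)
    (h : Wp body (Wp (.whileDo c body :: K) Q) s) : Wp (.whileDo c body :: K) Q s :=
  Wp.of_step (l := []) rfl (fun K o => by simp [State.step, hc]) (Wp.append h)

theorem Wp.whileDo_false {c : BoolExpr} (hc : c.eval s = some false)
    (h : Wp K Q s) : Wp (.whileDo c body :: K) Q s :=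
  Wp.of_step (l := []) rfl (fun K o => by simp [State.step, hc]) h

/-- The rule for loops with the invariant `I` and the variant `f`. -/
theorem Wp.whileDo {c : BoolExpr} (I : Store → Prop) (f : Store → ℕ) (h : I s)
    (hI : ∀ s, I s → ∃ v, c.eval s = some v ∧
      (v = true → Wp body (fun s' => I s' ∧ f s' < f s) s) ∧ (v = false → Wp K Q s)) :
    Wp (.whileDo c body :: K) Q s := by
  induction hk : f s using Nat.strong_induction_on generalizing s with
  | _ k ih =>
    obtain ⟨v, hv, ht, hf⟩ := hI s h
    cases v with
    | true => exact Wp.whileDo_true hv ((ht rfl).mono fun s' hs' => ih _ (hk ▸ hs'.2) hs'.1 rfl)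
    | false => exact Wp.whileDo_false hv (hf rfl)

/-- A `repeat` loop is one copy of its body followed by a `while` loop with the negated condition,
so a loop invariant is needed only after the first pass. -/
theorem Wp.repeatUntil {c : BoolExpr} (h : Wp body (Wp (.whileDo (.not c) body :: K) Q) s) :
    Wp (.repeatUntil body c :: K) Q s :=
  Wp.of_step (l := []) rfl (fun K o => by simp [State.step]) (Wp.append h)

/-- The rule for loops `for x from a to b`, where `I z` holds before the execution of the body
for `x = z`. -/
theorem Wp.forDo {x : IntVar} {a b : IntExpr} {lo hi : ℤ} (ha : a.eval s = some lo)
    (hb : b.eval s = some hi) (hlo : lo ≤ hi + 1) (I : ℤ → Store → Prop)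
    (h : I lo (s.setInt x lo))
    (hI : ∀ z s, lo ≤ z → z ≤ hi → s.int x = z → I z s →
      Wp body (fun s' => s'.int x = z ∧ I (z + 1) (s'.setInt x (z + 1))) s)
    (hQ : ∀ s, s.int x = hi + 1 → I (hi + 1) s → Wp K Q s) :
    Wp (.forDo x a b body :: K) Q s := by
  obtain ⟨k, hk⟩ := Int.eq_ofNat_of_zero_le (sub_nonneg.2 hlo)
  induction k generalizing s a b lo with
  | zero =>
    have hlo' : ¬ lo ≤ hi := by simp at hk; omega
    refine Wp.of_step (p' := K) (s' := s.setInt x lo) (l := []) rfl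
      (fun K o => by simp [State.step, ha, hb, hlo']) ?_
    obtain rfl : lo = hi + 1 := by simp at hk; omega
    exact hQ _ (by simp [Store.setInt]) h
  | succ k ih =>
    have hlo' : lo ≤ hi := by simp at hk; omega
    -- After the body the loop is resumed from `x + 1` with the upper bound frozen as a literal.
    -- This is why the invariant records that the body leaves `x` unchanged.
    refine Wp.of_step (p' := body ++ (.forDo x (x + 1) (.lit hi) body :: K))
      (s' := s.setInt x lo) (l := []) rfl (fun K o => by simp [State.step, ha, hb, hlo'])
      (Wp.append ?_)
    refine (hI lo _ le_rfl hlo' (by simp [Store.setInt]) h).mono fun s' hs' => ?_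
    refine ih (lo := lo + 1) ?_ rfl (by omega) hs'.2
      (fun z s hz => hI z s (by omega)) (by push_cast at hk ⊢; omega)
    change (IntExpr.eval (.add (.var x) (.lit 1)) s') = _
    simp [IntExpr.eval, hs'.1]

end

end MuPAD

namespace MuPAD

/-! ### The enumeration of tuples -/

/-- The maximum of the absolute values of the entries. -/
def supAbs : List ℤ → ℤ
  | [] => 0
  | x :: l => max |x| (supAbs l)

theorem supAbs_nonneg (l : List ℤ) : 0 ≤ supAbs l := by
  cases l <;> simp [supAbs]

theorem supAbs_le_iff {l : List ℤ} {b : ℤ} (hb : 0 ≤ b) : supAbs l ≤ b ↔ ∀ x ∈ l, |x| ≤ b := by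
  induction l with
  | nil => simpa [supAbs]
  | cons x l ih => simp [supAbs, ih]

theorem abs_le_supAbs {l : List ℤ} {x : ℤ} (hx : x ∈ l) : |x| ≤ supAbs l :=
  (supAbs_le_iff (supAbs_nonneg l)).1 le_rfl x hx

theorem exists_abs_eq_supAbs {l : List ℤ} (hl : l ≠ []) : ∃ x ∈ l, |x| = supAbs l := by
  induction l with
  | nil => exact absurd rfl hl
  | cons x l ih =>
    rcases le_total (supAbs l) |x| with h | h
    · exact ⟨x, by simp, by simp [supAbs, h]⟩
    · rcases eq_or_ne l [] with rfl | hl'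
      · exact ⟨x, by simp, by simp [supAbs]⟩
      · obtain ⟨y, hy, hy'⟩ := ih hl'
        exact ⟨y, by simp [hy], by simp [supAbs, h, hy']⟩

theorem supAbs_replicate {n : ℕ} (hn : n ≠ 0) (b : ℤ) : supAbs (List.replicate n b) = |b| := by
  obtain ⟨x, hx, h⟩ := exists_abs_eq_supAbs (l := List.replicate n b) (by simpa)
  rw [← h, List.eq_of_mem_replicate hx]

/-- The successor of a tuple with entries from `-b` to `b`, where the first entry varies
the fastest. -/
def odometer (b : ℤ) : List ℤ → List ℤ
  | [] => []
  | x :: l => if x = b then -b :: odometer b l else (x + 1) :: l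

/-- The number of predecessors of a tuple among the tuples with entries from `-b` to `b`. -/
def rank (b : ℤ) : List ℤ → ℤ
  | [] => 0
  | x :: l => x + b + (2 * b + 1) * rank b l

/-- The successor of a nonempty tuple in the enumeration by the program. -/
def nextList (l : List ℤ) : List ℤ :=
  if ∀ x ∈ l, x = supAbs l then List.replicate l.length (-supAbs l - 1)
  else if l.head? ≠ some (supAbs l) ∧ supAbs l.tail < supAbs l then supAbs l :: l.tail
  else odometer (supAbs l) l

theorem length_odometer (b : ℤ) (l : List ℤ) : (odometer b l).length = l.length := by
  induction l with
  | nil => rfl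
  | cons x l ih => by_cases h : x = b <;> simp [odometer, h, ih]

theorem odometer_replicate_append {b x : ℤ} (hx : x ≠ b) (p : ℕ) (l : List ℤ) :
    odometer b (List.replicate p b ++ x :: l) = List.replicate p (-b) ++ (x + 1) :: l := by
  induction p with
  | zero => simp [odometer, hx]
  | succ p ih => simp [List.replicate_succ, odometer, ih]

theorem abs_le_of_mem_odometer {b : ℤ} {l : List ℤ} (hl : ∀ x ∈ l, |x| ≤ b) :
    ∀ x ∈ odometer b l, |x| ≤ b := by
  induction l with
  | nil => simp [odometer]
  | cons x l ih =>
    simp only [List.mem_cons, forall_eq_or_imp] at hl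
    have h := abs_le.1 hl.1
    by_cases hx : x = b
    · simp only [odometer, hx, if_true, List.mem_cons, forall_eq_or_imp]
      exact ⟨by rw [abs_neg, ← hx]; simpa [hx] using hl.1, ih hl.2⟩
    · simp only [odometer, hx, if_false, List.mem_cons, forall_eq_or_imp]
      exact ⟨abs_le.2 ⟨by omega, by omega⟩, hl.2⟩

/-- `rank` reads the tuple as a numeral in base `2 * b + 1` with digits `x + b`, least significant
first; the odometer adds one with carry. An entry different from `b` keeps the carry from running
off the end. -/
theorem rank_odometer {b : ℤ} {l : List ℤ} (hl : ∃ x ∈ l, x ≠ b) :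
    rank b (odometer b l) = rank b l + 1 := by
  induction l with
  | nil => simp at hl
  | cons x l ih =>
    by_cases hx : x = b
    · subst hx
      have : ∃ y ∈ l, y ≠ x := by simpa using hl
      simp only [odometer, if_true, rank, ih this]
      ring
    · simp only [odometer, hx, if_false, rank]
      ring

theorem rank_nonneg {b : ℤ} {l : List ℤ} (hl : ∀ x ∈ l, |x| ≤ b) : 0 ≤ rank b l := by
  induction l with
  | nil => exact le_rfl
  | cons x l ih =>
    simp only [List.mem_cons, forall_eq_or_imp] at hl
    have h := abs_le.1 hl.1
    exact add_nonneg (by omega) (mul_nonneg (by omega) (ih hl.2))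

/-- Uniqueness of digits: two lowest digits differ by less than the base, so a difference divisible
by the base is zero. -/
theorem rank_injective {b : ℤ} {l l' : List ℤ} (hl : ∀ x ∈ l, |x| ≤ b) (hl' : ∀ x ∈ l', |x| ≤ b)
    (hlen : l.length = l'.length) (h : rank b l = rank b l') : l = l' := by
  induction l generalizing l' with
  | nil => exact (List.length_eq_zero_iff.1 hlen.symm).symm
  | cons x l ih =>
    obtain _ | ⟨y, l'⟩ := l'
    · simp at hlen
    simp only [List.mem_cons, forall_eq_or_imp, abs_le] at hl hl' ih
    simp only [rank] at h
    have h' : rank b l = rank b l' := by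
      have hb : 0 < 2 * b + 1 := by omega
      have h1 : (2 * b + 1) * (rank b l - rank b l') = y - x := by linarith
      have h2 : rank b l - rank b l' < 1 := by
        refine lt_of_mul_lt_mul_left ?_ hb.le
        rw [h1]; omega
      have h3 : -1 < rank b l - rank b l' := by
        refine lt_of_mul_lt_mul_left ?_ hb.le
        rw [h1]; omega
      omega
    rw [h'] at h
    rw [ih hl.2 hl'.2 (by simpa using hlen) h', show x = y by omega]

theorem rank_le_of_forall_eq {b : ℤ} {l l' : List ℤ} (hl : ∀ x ∈ l, x = b)
    (hl' : ∀ x ∈ l', |x| ≤ b) (hlen : l.length = l'.length) : rank b l' ≤ rank b l := by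
  induction l generalizing l' with
  | nil => rw [List.length_eq_zero_iff.1 hlen.symm]
  | cons x l ih =>
    obtain _ | ⟨y, l'⟩ := l'
    · simp at hlen
    simp only [List.mem_cons, forall_eq_or_imp] at hl hl'
    have h := abs_le.1 hl'.1
    exact add_le_add (by omega)
      (mul_le_mul_of_nonneg_left (ih hl.2 hl'.2 (by simpa using hlen)) (by omega))

theorem length_nextList {l : List ℤ} (hl : l ≠ []) : (nextList l).length = l.length := by
  unfold nextList
  split_ifs
  · simp
  · have := List.length_pos_iff.2 hl
    simp only [List.length_cons, List.length_tail]
    omega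
  · exact length_odometer _ _

/-- The maximum `b` is still attained: the new head is `b` or `-b`, unless the head is merely
incremented, and in that case the tail already has maximum `b`. -/
theorem supAbs_nextList {l : List ℤ} (hl : l ≠ []) (h : ∃ x ∈ l, x ≠ supAbs l) :
    supAbs (nextList l) = supAbs l := by
  have h0 := supAbs_nonneg l
  rw [nextList, if_neg (by push Not; exact h)]
  obtain ⟨x, t, rfl⟩ := List.exists_cons_of_ne_nil hl
  set b := supAbs (x :: t) with hb
  have hb' : b = max |x| (supAbs t) := hb
  simp only [List.head?_cons, ne_eq, Option.some.injEq, List.tail_cons]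
  split_ifs with h1
  · rw [supAbs, abs_of_nonneg h0]
    exact max_eq_left h1.2.le
  · refine le_antisymm ((supAbs_le_iff h0).2
      (abs_le_of_mem_odometer fun y hy => abs_le_supAbs hy)) ?_
    by_cases hx : x = b
    · simp [odometer, hx, supAbs, abs_of_nonneg h0]
    · simp only [odometer, hx, if_false, supAbs]
      push Not at h1
      exact le_max_of_le_right (h1 hx)

theorem supAbs_le_supAbs_nextList {l : List ℤ} (hl : l ≠ []) : supAbs l ≤ supAbs (nextList l) := by
  by_cases h : ∃ x ∈ l, x ≠ supAbs l
  · exact (supAbs_nextList hl h).ge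
  · have h0 := supAbs_nonneg l
    push Not at h
    rw [nextList, if_pos h, supAbs_replicate (by simpa), abs_of_nonpos (by omega)]
    omega

/-- The shortcut from head `-b` to head `b` skips only tuples whose head lies strictly between and
whose tail has maximum below `b`; these do not have maximum `b`. So no tuple `l'` of the same
maximum is jumped over, and iteration must hit it. -/
theorem rank_nextList {l l' : List ℤ} (hl : l ≠ []) (h : supAbs l' = supAbs l)
    (hlen : l.length = l'.length) (hlt : rank (supAbs l) l < rank (supAbs l) l') :
    supAbs (nextList l) = supAbs l ∧ rank (supAbs l) l < rank (supAbs l) (nextList l) ∧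
      rank (supAbs l) (nextList l) ≤ rank (supAbs l) l' := by
  have h0 := supAbs_nonneg l
  have hl'b : ∀ x ∈ l', |x| ≤ supAbs l := fun x hx => h ▸ abs_le_supAbs hx
  have hex : ∃ x ∈ l, x ≠ supAbs l := by
    by_contra! hex
    exact hlt.not_ge (rank_le_of_forall_eq hex hl'b hlen)
  refine ⟨supAbs_nextList hl hex, ?_⟩
  rw [nextList, if_neg (by push Not; exact hex)]
  split_ifs with h1
  swap
  · rw [rank_odometer hex]; omega
  obtain ⟨x, t, rfl⟩ := List.exists_cons_of_ne_nil hl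
  obtain _ | ⟨y, t'⟩ := l'
  · simp at hlen
  have hb' : supAbs (x :: t) = max |x| (supAbs t) := rfl
  have hb'' : supAbs (y :: t') = max |y| (supAbs t') := rfl
  set b := supAbs (x :: t) with hb
  simp only [List.head?_cons, ne_eq, Option.some.injEq, List.tail_cons] at h1
  have hx : x = -b := by
    have : b = |x| := by
      rcases max_choice |x| (supAbs t) with h2 | h2 <;> omega
    rcases abs_choice x with h2 | h2 <;> omega
  simp only [List.mem_cons, forall_eq_or_imp, abs_le] at hl'b
  simp only [rank, List.tail_cons] at hlt ⊢
  have ht : rank b t ≤ rank b t' := by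
    have : (2 * b + 1) * rank b t < (2 * b + 1) * (rank b t' + 1) := by linarith
    have := lt_of_mul_lt_mul_left this (by omega)
    omega
  refine ⟨by omega, ?_⟩
  rcases ht.eq_or_lt with ht | ht
  -- With equal tails the maximum of `l'` must come from its head, so `y = ±b`. The strict
  -- inequality of ranks excludes `-b`, and `b` is the target of the jump.
  · have htt : t = t' := by
      refine rank_injective (b := b) (fun z hz => ?_) (fun z hz => abs_le.2 (hl'b.2 z hz))
        (by simpa using hlen) ht
      exact abs_le_supAbs (List.mem_cons_of_mem _ hz)
    have hy : |y| = b := by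
      have htt' : supAbs t = supAbs t' := by rw [htt]
      rw [← htt'] at hb''
      rcases max_choice |y| (supAbs t) with h2 | h2 <;> omega
    have : y ≠ -b := by
      rintro rfl
      rw [ht] at hlt
      omega
    have : y = b := by rcases abs_choice y with h2 | h2 <;> omega
    rw [this, ht]
  · have : (2 * b + 1) * (rank b t + 1) ≤ (2 * b + 1) * rank b t' :=
      mul_le_mul_of_nonneg_left ht (by omega)
    linarith [hl'b.1.1]

theorem iterate_nextList_of_supAbs_eq {l l' : List ℤ} (hl : l ≠ []) (h : supAbs l' = supAbs l)
    (hlen : l.length = l'.length) (hle : rank (supAbs l) l ≤ rank (supAbs l) l') :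
    ∃ j, nextList^[j] l = l' := by
  obtain ⟨k, hk⟩ := Int.eq_ofNat_of_zero_le (sub_nonneg.2 hle)
  induction k using Nat.strong_induction_on generalizing l with
  | _ k ih =>
    rcases hle.eq_or_lt with he | hlt
    · exact ⟨0, rank_injective (fun _ => abs_le_supAbs) (fun _ hx => h ▸ abs_le_supAbs hx) hlen he⟩
    · obtain ⟨h1, h2, h3⟩ := rank_nextList hl h hlen hlt
      have hlen' := length_nextList hl
      rw [← h1] at h2 h3 hk
      have hne : nextList l ≠ [] := by
        rw [← List.length_pos_iff] at hl ⊢; omega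
      obtain ⟨j, hj⟩ := ih (rank (supAbs (nextList l)) l' -
        rank (supAbs (nextList l)) (nextList l)).toNat (by omega) hne (by omega) (by omega) h3
        (by rw [Int.toNat_of_nonneg (by omega)])
      exact ⟨j + 1, by rw [Function.iterate_succ_apply]; exact hj⟩

theorem rank_replicate_neg (b : ℤ) (n : ℕ) : rank b (List.replicate n (-b)) = 0 := by
  induction n with
  | zero => rfl
  | succ n ih => simp [List.replicate_succ, rank, ih]

/-- The enumeration that starts with `(-b, …, -b)` reaches every tuple with an entry of absolute
value at least `b`. -/
theorem iterate_nextList_replicate {n : ℕ} (hn : n ≠ 0) {b : ℤ} (hb : 0 ≤ b) {l : List ℤ}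
    (hlen : l.length = n) (hl : b ≤ supAbs l) :
    ∃ j, nextList^[j] (List.replicate n (-b)) = l := by
  obtain ⟨k, hk⟩ := Int.eq_ofNat_of_zero_le (sub_nonneg.2 hl)
  have key : ∀ {b : ℤ} {l : List ℤ}, 0 ≤ b → l.length = n → supAbs l = b →
      ∃ j, nextList^[j] (List.replicate n (-b)) = l := by
    intro b l hb hlen hl
    have h1 : supAbs (List.replicate n (-b)) = b := by
      rw [supAbs_replicate hn, abs_neg, abs_of_nonneg hb]
    refine iterate_nextList_of_supAbs_eq (by simpa) (by omega) (by simp [hlen]) ?_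
    rw [h1, rank_replicate_neg]
    exact rank_nonneg fun x hx => hl ▸ abs_le_supAbs hx
  induction k generalizing b with
  | zero => exact key hb hlen (by push_cast at hk; omega)
  | succ k ih =>
    -- The tuple with all entries `b` is the last one of maximum `b`; its successor opens the
    -- enumeration for `b + 1`.
    obtain ⟨i, hi⟩ := key (l := List.replicate n b) hb (by simp)
      (by rw [supAbs_replicate hn, abs_of_nonneg hb])
    obtain ⟨j, hj⟩ := ih (b := b + 1) (by omega) (by push_cast at hk; omega)
      (by push_cast at hk ⊢; omega)
    refine ⟨j + 1 + i, ?_⟩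
    rw [Function.iterate_add_apply, hi, Function.iterate_succ_apply, nextList, if_pos]
    · rw [supAbs_replicate hn, abs_of_nonneg hb, List.length_replicate, ← hj]
      congr 2
      ring
    · intro x hx
      rw [supAbs_replicate hn, abs_of_nonneg hb, List.eq_of_mem_replicate hx]

theorem length_iterate_nextList {l : List ℤ} (hl : l ≠ []) (j : ℕ) :
    (nextList^[j] l).length = l.length := by
  induction j with
  | zero => rfl
  | succ j ih =>
    rw [Function.iterate_succ_apply', length_nextList, ih]
    rwa [← List.length_pos_iff, ih, List.length_pos_iff]

theorem monotone_supAbs_iterate_nextList {l : List ℤ} (hl : l ≠ []) :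
    Monotone fun j => supAbs (nextList^[j] l) := by
  refine monotone_nat_of_le_succ fun j => ?_
  rw [Function.iterate_succ_apply']
  refine supAbs_le_supAbs_nextList ?_
  rwa [← List.length_pos_iff, length_iterate_nextList hl, List.length_pos_iff]

end MuPAD

namespace MuPAD

open IntVar ListVar

/-! ### Evaluation -/

@[simp] theorem Store.setInt_int (s : Store) (x y : IntVar) (z : ℤ) :
    (s.setInt x z).int y = if y = x then z else s.int y := by
  simp [Store.setInt, Function.update_apply]

@[simp] theorem Store.setInt_list (s : Store) (x : IntVar) (z : ℤ) :
    (s.setInt x z).list = s.list := rfl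

@[simp] theorem Store.setList_int (s : Store) (L : ListVar) (l : List ℤ) :
    (s.setList L l).int = s.int := rfl

@[simp] theorem Store.setList_list (s : Store) (L : ListVar) (l : List ℤ) :
    (s.setList L l).list = Function.update s.list L l := rfl

section
variable (a c : IntExpr) (s : Store)

@[simp] theorem eval_zero : (0 : IntExpr).eval s = some 0 := rfl
@[simp] theorem eval_one : (1 : IntExpr).eval s = some 1 := rfl
@[simp] theorem eval_two : (2 : IntExpr).eval s = some 2 := rfl
@[simp] theorem eval_three : (3 : IntExpr).eval s = some 3 := rfl
@[simp] theorem eval_four : (4 : IntExpr).eval s = some 4 := rfl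
@[simp] theorem eval_five : (5 : IntExpr).eval s = some 5 := rfl

@[simp] theorem eval_var (x : IntVar) : (IntExpr.var x).eval s = some (s.int x) := rfl

@[simp] theorem eval_nops (L : ListVar) :
    (IntExpr.nops L).eval s = some ((s.list L).length : ℤ) := rfl

@[simp] theorem eval_add : (a + c).eval s =
    (a.eval s).bind fun x => (c.eval s).bind fun y => some (x + y) := rfl

@[simp] theorem eval_sub : (a - c).eval s =
    (a.eval s).bind fun x => (c.eval s).bind fun y => some (x - y) := rfl

@[simp] theorem eval_mul : (a * c).eval s =
    (a.eval s).bind fun x => (c.eval s).bind fun y => some (x * y) := rfl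

@[simp] theorem eval_neg : (-a).eval s = (a.eval s).bind fun x => some (-x) := rfl

@[simp] theorem eval_abs : (IntExpr.abs a).eval s = (a.eval s).bind fun x => some |x| := rfl

@[simp] theorem eval_eq : (BoolExpr.eq a c).eval s =
    (a.eval s).bind fun x => (c.eval s).bind fun y => some (decide (x = y)) := rfl

@[simp] theorem eval_ne : (BoolExpr.ne a c).eval s =
    (a.eval s).bind fun x => (c.eval s).bind fun y => some (decide (x ≠ y)) := rfl

@[simp] theorem eval_lt : (BoolExpr.lt a c).eval s =
    (a.eval s).bind fun x => (c.eval s).bind fun y => some (decide (x < y)) := rfl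

@[simp] theorem eval_le : (BoolExpr.le a c).eval s =
    (a.eval s).bind fun x => (c.eval s).bind fun y => some (decide (x ≤ y)) := rfl

@[simp] theorem eval_not (d : BoolExpr) :
    (BoolExpr.not d).eval s = (d.eval s).bind fun v => some (!v) := rfl

@[simp] theorem eval_and (d e : BoolExpr) : (BoolExpr.and d e).eval s =
    (d.eval s).bind fun v => if v = true then e.eval s else some false := rfl

@[simp] theorem eval_or (d e : BoolExpr) : (BoolExpr.or d e).eval s =
    (d.eval s).bind fun v => if v = true then some true else e.eval s := rfl

@[simp] theorem eval_listVar (L : ListVar) : (ListExpr.var L).eval s = some (s.list L) := rfl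

@[simp] theorem eval_append (l : ListExpr) : (ListExpr.append l a).eval s =
    (l.eval s).bind fun x => (a.eval s).bind fun y => some (x ++ [y]) := rfl

end

/-- The entry `l[z]`, where `1 ≤ z ≤ nops(l)`. -/
def entry (l : List ℤ) (z : ℤ) : ℤ := l.getD (z - 1).toNat 0

theorem eval_get {L : ListVar} {a : IntExpr} {s : Store} {z : ℤ} (ha : a.eval s = some z)
    (hz : 1 ≤ z) (hz' : z ≤ (s.list L).length) :
    (IntExpr.get L a).eval s = some (entry (s.list L) z) := by
  have h : (z - 1).toNat < (s.list L).length := by omega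
  rw [IntExpr.eval, ha, Option.bind_eq_bind, Option.bind_eq_bind, Option.bind_some, position,
    if_pos ⟨hz, hz'⟩, Option.bind_some, entry, List.getD_eq_getElem _ _ h,
    List.getElem?_eq_getElem h]

theorem mapM_eq_some_map {α β : Type*} {f : α → Option β} {g : α → β} {l : List α}
    (h : ∀ x ∈ l, f x = some (g x)) : l.mapM f = some (l.map g) := by
  induction l with
  | nil => rfl
  | cons x l ih =>
    simp only [List.mem_cons, forall_eq_or_imp] at h
    simp [List.mapM_cons, h.1, ih h.2]

theorem eval_maxSeq {e a c : IntExpr} {x : IntVar} {s : Store} {lo hi : ℤ}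
    (ha : a.eval s = some lo) (hc : c.eval s = some hi) :
    (IntExpr.maxSeq e x a c).eval s =
      (((List.range (hi + 1 - lo).toNat).map fun k : ℕ => (k : ℤ)).mapM fun k =>
        e.eval (s.setInt x (lo + k))).bind List.max? := by
  simp only [IntExpr.eval, ha, hc, Option.bind_eq_bind, Option.bind_some]
  congr 2
  -- In the semantics the index list is coerced from `ℕ` to `ℤ` monadically, which gives a `flatMap`
  -- with `pure` instead of a `map`.
  exact List.flatMap_pure_eq_map _ _

theorem eval_maxAbs {L : ListVar} {a : IntExpr} {s : Store} {z : ℤ} (ha : a.eval s = some z)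
    (hz : 1 ≤ z) (hz' : z ≤ (s.list L).length) (hn : s.int n = (s.list L).length) :
    (maxAbs L a).eval s = some (supAbs ((s.list L).drop (z - 1).toNat)) := by
  have h : ∀ k ∈ (List.range (s.int n + 1 - z).toNat).map fun k : ℕ => (k : ℤ),
      ((IntExpr.get L t).abs).eval (s.setInt t (z + k)) = some |entry (s.list L) (z + k)| := by
    intro k hk
    simp only [List.mem_map, List.mem_range] at hk
    obtain ⟨i, hi, rfl⟩ := hk
    rw [eval_abs, eval_get (z := z + i) (by simp) (by omega) (by simp; omega)]
    simp
  have hmap : ((List.range (s.int n + 1 - z).toNat).map fun k : ℕ => (k : ℤ)).map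
      (fun k => |entry (s.list L) (z + k)|) =
      ((s.list L).drop (z - 1).toNat).map abs := by
    refine List.ext_getElem (by simp; omega) fun i h1 h2 => ?_
    simp only [List.length_map, List.length_drop] at h2
    have h3 : (z + i - 1).toNat = (z - 1).toNat + i := by omega
    have h4 : (z - 1).toNat + i < (s.list L).length := by omega
    simp only [List.getElem_map, List.getElem_range, List.getElem_drop, entry, h3,
      List.getD_eq_getElem _ _ h4]
  rw [maxAbs, eval_maxSeq ha (eval_var s n), mapM_eq_some_map h, hmap, Option.bind_some,
    List.max?_eq_some_iff]
  have hne : (s.list L).drop (z - 1).toNat ≠ [] := by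
    rw [← List.length_pos_iff, List.length_drop]; omega
  constructor
  · obtain ⟨x, hx, hx'⟩ := exists_abs_eq_supAbs hne
    exact List.mem_map.2 ⟨x, hx, hx'⟩
  · intro y hy
    obtain ⟨x, hx, rfl⟩ := List.mem_map.1 hy
    exact abs_le_supAbs hx

/-! ### The fragments of the code -/

/-- The counter `t` decides only whether lists are displayed, so its value is irrelevant. What
matters is that no index error occurs and that the lists and `n` survive. -/
theorem Wp.countEquations {s : Store} (hn : s.int n = (s.list X).length) :
    Wp countEquations (fun s' => s'.list = s.list ∧ s'.int n = s.int n) s := by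
  refine .assign (by simp; rfl) (.forDo (by simp; rfl) (by simp; rfl) (by simp; omega)
    (fun _ s' => s'.list = s.list ∧ s'.int n = s.int n) (by simp) ?_
    fun s' _ h => .nil h)
  rintro z1 s1 hz1 hz1' h1 ⟨hl1, hn1⟩
  refine .forDo (lo := z1) (hi := s.int n) (by simp [h1]) (by simp [hn1]) (by omega)
    (fun _ s' => s'.list = s.list ∧ s'.int n = s.int n ∧ s'.int t1 = z1)
    (by simp [hl1, hn1, h1]) ?_
    fun s' _ h => .nil (by simp [h])
  rintro z2 s2 hz2 hz2' h2 ⟨hl2, hn2, h12⟩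
  refine .forDo (lo := 1) (hi := s.int n) (by simp) (by simp [hn2]) (by omega)
    (fun _ s' => s'.list = s.list ∧ s'.int n = s.int n ∧ s'.int t1 = z1 ∧ s'.int t2 = z2)
    (by simp [hl2, hn2, h2, h12]) ?_
    fun s' _ h => .nil (by simp [h])
  rintro z3 s3 hz3 hz3' h3 ⟨hl3, hn3, h13, h23⟩
  have g : ∀ (s' : Store) (x : IntVar) (z : ℤ), s'.list = s.list → s'.int x = z → 1 ≤ z →
      z ≤ s.int n → (IntExpr.get X x).eval s' = some (entry (s.list X) z) := by
    intro s' x z hl hx h h'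
    rw [← hl]
    exact eval_get (by simp [hx]) h (by rw [hl]; omega)
  have fin : ∀ s' : Store, s'.list = s.list ∧ s'.int n = s.int n ∧ s'.int t1 = z1 ∧
      s'.int t2 = z2 ∧ s'.int t3 = z3 → Wp [Stmt.ifThen (.eq (.get X t1 * .get X t2) (.get X t3))
      [.assign t (t + 1)]] (fun s' => s'.int t3 = z3 ∧ (s'.setInt t3 (z3 + 1)).list = s.list ∧
        (s'.setInt t3 (z3 + 1)).int n = s.int n ∧ (s'.setInt t3 (z3 + 1)).int t1 = z1 ∧
        (s'.setInt t3 (z3 + 1)).int t2 = z2) s' := by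
    rintro s' ⟨hl, hn, h1, h2, h3⟩
    refine .ifThen (by
      rw [eval_eq, eval_mul, g s' t1 z1 hl h1 hz1 hz1', g s' t2 z2 hl h2 (by omega) hz2',
        g s' t3 z3 hl h3 (by omega) hz3']
      simp; rfl) ?_ ?_
    · intro _
      exact .assign (by simp; rfl) (.nil (.nil (by simp [hl, hn, h1, h2, h3])))
    · intro _
      exact .nil (by simp [hl, hn, h1, h2, h3])
  refine .ifThen (by
    rw [eval_eq, eval_add, g s3 t1 z1 hl3 h13 hz1 hz1', g s3 t2 z2 hl3 h23 (by omega) hz2',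
      g s3 t3 z3 hl3 h3 (by omega) hz3']
    simp; rfl) ?_ ?_
  · intro _
    exact .assign (by simp; rfl) (.nil (fin _ (by simp [hl3, hn3, h13, h23, h3])))
  · intro _
    exact fin _ (by simp [hl3, hn3, h13, h23, h3])

end MuPAD

namespace MuPAD

open IntVar ListVar

/-! ### The program fragment that computes the successor of a tuple -/

theorem set_replicate_append (i k : ℕ) (c d : ℤ) (r : List ℤ) :
    (List.replicate i c ++ (List.replicate (k + 1) d ++ r)).set i c =
      List.replicate (i + 1) c ++ (List.replicate k d ++ r) := by
  rw [List.set_append, if_neg (by simp)]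
  rw [List.replicate_succ' (n := i), List.append_assoc]
  simp [List.replicate_succ]

theorem entry_replicate_append (p : ℕ) (c x : ℤ) (r : List ℤ) {z : ℤ} (hz : z = p + 1) :
    entry (List.replicate p c ++ x :: r) z = x := by
  subst hz
  simp [entry]

/-- The loop counts the `p` leading entries equal to the maximum and ends with `q = p + 1`. The
cases `r = []`, `p = 0` and `p > 0` lead to the branches of `nextList`. Length at least `2` is
needed since `w` is a maximum over positions `2..n`, an error if there are none. -/
theorem Wp.nextTuple (L : ListVar) {s : Store} (hlen : 2 ≤ (s.list L).length)
    (hn : s.int n = (s.list L).length) :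
    Wp (nextTuple L) (fun s' => s'.list = Function.update s.list L (nextList (s.list L)) ∧
      s'.int n = s.int n ∧ s'.int m = s.int m) s := by
  set l := s.list L with hl
  have hlne : l ≠ [] := by rw [← List.length_pos_iff]; omega
  have hl0 := supAbs_nonneg l
  refine .assign (eval_maxAbs (eval_one s) le_rfl (by rw [← hl]; omega) hn) ?_
  refine .assign (eval_maxAbs (eval_two _) (by omega) (by simp [← hl]; omega)
    (by simp [← hl, hn])) ?_
  refine .assign (eval_one _) ?_
  simp only [Store.setInt_list, ← hl]
  have d0 : l.drop (1 - 1 : ℤ).toNat = l := by simp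
  have d1 : l.drop (2 - 1 : ℤ).toNat = l.tail := by simp
  rw [d0, d1]
  refine Wp.whileDo (fun s' => s'.list = s.list ∧ s'.int n = s.int n ∧ s'.int m = s.int m ∧
      s'.int b = supAbs l ∧ s'.int w = supAbs l.tail ∧ ∃ (p : ℕ) (r : List ℤ),
        s'.int q = p + 1 ∧ l = List.replicate p (supAbs l) ++ r)
    (fun s' => (s'.int n + 1 - s'.int q).toNat) ?_ ?_
  · exact ⟨rfl, by simp, by simp, by simp, by simp, 0, l, by simp, by simp⟩
  rintro s' ⟨hl', hn', hm', hb', hw', p, r, hq', hr⟩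
  have hlen' := congrArg List.length hr
  simp only [List.length_append, List.length_replicate] at hlen'
  obtain _ | ⟨x, r⟩ := r
  · -- all entries are equal to the maximum
    simp only [List.length_nil, add_zero] at hlen'
    refine ⟨false, ?_, by simp, fun _ => ?_⟩
    · simp [hq', hn', hn, hlen']
    refine .ifThen (v := false) (by simp [hq']; omega) (by simp) fun _ => ?_
    refine .ifThen (v := false) (by simp [hq']; omega) (by simp) fun _ => ?_
    refine .ifThen (v := false) (by simp [hq', hn', hn, hlen']) (by simp) fun _ => ?_
    refine .ifThen (v := true) (by simp [hq', hn', hn, hlen']) (fun _ => ?_) (by simp)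
    refine .assignList (l := []) rfl ?_
    refine .forDo (lo := 1) (hi := s.int n) (by simp) (by simp [hn']) (by omega)
      (fun z s' => s'.int n = s.int n ∧ s'.int m = s.int m ∧ s'.int b = supAbs l ∧
        s'.list = Function.update s.list L (List.replicate (z - 1).toNat (-supAbs l - 1)))
      (by simp [hn', hm', hb', hl']) ?_ ?_
    · rintro z s1 hz hz' h1 ⟨hn1, hm1, hb1, hl1⟩
      refine .assignList (by simp; rfl) (.nil ?_)
      have : (z + 1 - 1).toNat = (z - 1).toNat + 1 := by omega
      simp only [Store.setList_int, Store.setInt_list, Store.setList_list, Store.setInt_int,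
        reduceCtorEq, if_false, hl1, Function.update_self, Function.update_idem, this, hb1,
        List.replicate_succ', h1, hn1, hm1, and_self]
    · rintro s1 h1 ⟨hn1, hm1, hb1, hl1⟩
      refine .nil (.nil ⟨?_, hn1, hm1⟩)
      have : (s.int n + 1 - 1).toNat = l.length := by omega
      rw [hl1, this, nextList, if_pos]
      intro y hy
      rw [hr, List.append_nil] at hy
      exact List.eq_of_mem_replicate hy
  simp only [List.length_cons] at hlen'
  have hget : (IntExpr.get L q).eval s' = some x := by
    rw [eval_get (z := p + 1) (by simp [hq']) (by omega) (by rw [hl', ← hl]; omega), hl', ← hl, hr,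
      entry_replicate_append _ _ _ _ rfl]
  by_cases hx : x = supAbs l
  · refine ⟨true, ?_, fun _ => ?_, by simp⟩
    · rw [eval_and, eval_eq, hget]
      simp [hq', hb', hn', hx]
      omega
    · refine .assign (by simp; rfl) (.nil ?_)
      simp only [Store.setInt_list, Store.setInt_int, reduceCtorEq, if_false, if_true]
      refine ⟨⟨hl', hn', hm', hb', hw', p + 1, r, by push_cast; omega, ?_⟩, by omega⟩
      rw [List.replicate_succ', List.append_assoc, List.singleton_append]
      rw [hx] at hr
      exact hr
  refine ⟨false, ?_, by simp, fun _ => ?_⟩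
  · rw [eval_and, eval_eq, hget]
    simp [hb', hx]
  have hex : ¬ ∀ y ∈ l, y = supAbs l := fun h => hx (h x (by rw [hr]; simp))
  obtain _ | p := p
  · have hlx : l = x :: r := by simpa using hr
    have htail : l.tail = r := by rw [hlx]; rfl
    have hhead : l.head? ≠ some (supAbs l) := by
      intro h
      have h' : l.head? = some x := by rw [hlx]; rfl
      exact hx (Option.some.inj (h'.symm.trans h))
    have hle : supAbs l.tail ≤ supAbs l := by
      rw [hlx]; exact le_max_right _ _
    have hq1 : s'.int q = 1 := by simpa using hq'
    rcases hle.lt_or_eq with hlt | heq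
    · refine .ifThen (v := true) (by simp [hq1, hw', hb', hlt]) (fun _ => ?_) (by simp)
      refine .assignEntry (by simp) le_rfl (by rw [hl', ← hl]; omega) (by simp; rfl)
        (.nil ?_)
      -- The variables `w` and `b` are not recomputed after the change of the first entry, so the
      -- second conditional does not fire as well.
      refine .ifThen (v := false) (by simp [hq1, hw', hb', hlt.ne]) (by simp) fun _ => ?_
      refine .ifThen (v := false) (by simp [hq1]) (by simp) fun _ => ?_
      refine .ifThen (v := false) (by simp [hq1, hn']; omega) (by simp) fun _ => .nil ?_
      refine ⟨?_, hn', hm'⟩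
      rw [nextList, if_neg hex, if_pos ⟨hhead, hlt⟩]
      simp only [Store.setList_list, hl', ← hl, hb', sub_self, Int.toNat_zero]
      nth_rw 1 [hlx]
      rw [htail, List.set_cons_zero]
    · refine .ifThen (v := false) (by simp [hq1, hw', hb', heq]) (by simp) fun _ => ?_
      refine .ifThen (v := true) (by simp [hq1, hw', hb', heq]) (fun _ => ?_) (by simp)
      have hget1 : (IntExpr.get L 1).eval s' = some x := by
        rw [eval_get (z := 1) (by simp) le_rfl (by rw [hl', ← hl]; omega), hl', ← hl,
          hlx]
        simp [entry]
      refine .assignEntry (by simp) le_rfl (by rw [hl', ← hl]; omega)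
        (y := x + 1) (by simp [hget1]) (.nil ?_)
      refine .ifThen (v := false) (by simp [hq1]) (by simp) fun _ => ?_
      refine .ifThen (v := false) (by simp [hq1, hn']; omega) (by simp) fun _ => .nil ?_
      refine ⟨?_, hn', hm'⟩
      rw [nextList, if_neg hex, if_neg (by rw [heq]; simp)]
      simp only [Store.setList_list, hl', ← hl, sub_self, Int.toNat_zero]
      nth_rw 1 [hlx]
      rw [List.set_cons_zero]
      conv_rhs => rw [hlx, odometer, ← hlx, if_neg hx]
  · push_cast at hq'
    refine .ifThen (v := false) (by simp [hq']; omega) (by simp) fun _ => ?_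
    refine .ifThen (v := false) (by simp [hq']; omega) (by simp) fun _ => ?_
    refine .ifThen (v := true) (by simp [hq', hn']; omega) (fun _ => ?_) (by simp)
    refine .forDo (lo := 1) (hi := p + 1) (by simp) (by simp [hq']) (by omega)
      (fun z s1 => s1.int n = s.int n ∧ s1.int m = s.int m ∧ s1.int b = supAbs l ∧
        s1.int q = p + 2 ∧
        s1.list = Function.update s.list L (List.replicate (z - 1).toNat (-supAbs l) ++
          (List.replicate (p + 1 - (z - 1).toNat) (supAbs l) ++ x :: r))) ?_ ?_ ?_
    · refine ⟨by simp [hn'], by simp [hm'], by simp [hb'], by simp [hq']; omega, ?_⟩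
      simp only [Store.setInt_list, sub_self, Int.toNat_zero, Nat.sub_zero, List.replicate_zero,
        List.nil_append]
      rw [← hr, hl, Function.update_eq_self, hl']
    · rintro z s1 hz hz' h1 ⟨hn1, hm1, hb1, hq1, hl1⟩
      have e1 : p + 1 - (z - 1).toNat = (p - (z - 1).toNat) + 1 := by omega
      have e2 : p + 1 - (z + 1 - 1).toNat = p - (z - 1).toNat := by omega
      have e3 : (z + 1 - 1).toNat = (z - 1).toNat + 1 := by omega
      refine .assignEntry (z := z) (by simp [h1]) hz (by
        rw [hl1, Function.update_self]; simp; omega) (y := -supAbs l) (by simp [hb1]) (.nil ?_)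
      simp only [Store.setList_int, Store.setInt_list, Store.setList_list, Store.setInt_int,
        reduceCtorEq, if_false, hl1, Function.update_self, Function.update_idem,
        h1, hn1, hm1, hb1, hq1, true_and]
      rw [e1, set_replicate_append, e2, e3]
    · rintro s1 h1 ⟨hn1, hm1, hb1, hq1, hl1⟩
      have e1 : ((p : ℤ) + 1 + 1 - 1).toNat = p + 1 := by omega
      rw [e1, Nat.sub_self, List.replicate_zero, List.nil_append] at hl1
      have hget1 : (IntExpr.get L q).eval s1 = some x := by
        rw [eval_get (z := p + 2) (by simp [hq1]) (by omega)
          (by rw [hl1, Function.update_self]; simp; omega), hl1, Function.update_self,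
          entry_replicate_append _ _ _ _ (by push_cast; ring)]
      refine .assignEntry (z := p + 2) (by simp [hq1]) (by omega)
          (by rw [hl1, Function.update_self]; simp; omega)
        (y := x + 1) (by simp [hget1]) (.nil ?_)
      refine .ifThen (v := false) (by simp [hq1, hn1]; omega) (by simp) fun _ => .nil ?_
      refine ⟨?_, hn1, hm1⟩
      have e2 : ((p : ℤ) + 2 - 1).toNat = p + 1 := by omega
      have hhead : l.head? = some (supAbs l) := by
        conv_lhs => rw [hr]
        simp [List.replicate_succ]
      rw [nextList, if_neg hex, if_neg (by rw [hhead]; simp)]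
      simp only [Store.setList_list, hl1, Function.update_self, Function.update_idem, e2]
      congr 1
      have hodo := odometer_replicate_append hx (p + 1) r
      rw [← hr] at hodo
      rw [hodo]
      rw [List.set_append, if_neg (by simp)]
      simp

end MuPAD

namespace MuPAD

open IntVar ListVar

/-! ### Comparing the equations of two tuples -/

/-- The entries of `l'` satisfy the equation `x_i + x_j = x_k` or `x_i * x_j = x_k` whenever the
entries of `l` do. -/
def Respects (l l' : List ℤ) (i j k : ℤ) : Prop :=
  (entry l i + entry l j = entry l k → entry l' i + entry l' j = entry l' k) ∧
    (entry l i * entry l j = entry l k → entry l' i * entry l' j = entry l' k)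

/-- The entries of `l'` satisfy all additive and multiplicative equations of `l`. -/
def ListHom (l l' : List ℤ) : Prop :=
  ∀ i j k : ℤ, 1 ≤ i → i ≤ l.length → 1 ≤ j → j ≤ l.length → 1 ≤ k → k ≤ l.length →
    Respects l l' i j k

/-- The triple that is visited by the program after `(i, j, k)`. -/
def nextTriple (n i j k : ℤ) : List ℤ :=
  if i ≠ n then [i + 1, j, k] else if j ≠ n then [j + 1, j + 1, k] else [1, 1, k + 1]

/-- The loop leaves in `i` the first position of `S` whose entry is not `n`, or `4` if there is
none. Lazy evaluation avoids the access to `S[4]`, and the values `3` and `4` are treated alike. -/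
theorem Wp.advance {K : List Stmt} {Q : Store → Prop} {s : Store} {c1 c2 c3 : ℤ}
    (hS : s.list S = [c1, c2, c3])
    (h : ∀ s' : Store, s'.list = Function.update s.list S (nextTriple (s.int n) c1 c2 c3) →
      s'.int n = s.int n → s'.int m = s.int m → Wp K Q s') :
    Wp (.assign i 1 ::
      .whileDo (.and (.le i 3) (.eq (.get S i) n)) [.assign i (i + 1)] ::
      .ifThen (.eq i 1) [.assignEntry S 1 (.get S 1 + 1)] ::
      .ifThen (.eq i 2) [
        .assignEntry S 1 (.get S 2 + 1),
        .assignEntry S 2 (.get S 2 + 1)] ::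
      .ifThen (.or (.eq i 3) (.eq i 4)) [
        .assignEntry S 1 1,
        .assignEntry S 2 1,
        .assignEntry S 3 (.get S 3 + 1)] :: K) Q s := by
  have g : ∀ (s' : Store) (a : IntExpr) (z : ℤ), s'.list = s.list → a.eval s' = some z → 1 ≤ z →
      z ≤ 3 → (IntExpr.get S a).eval s' = some (entry [c1, c2, c3] z) := by
    intro s' a z hl ha h1 h3
    rw [eval_get ha h1 (by rw [hl, hS]; simpa using h3), hl, hS]
  refine .assign (eval_one s) ?_
  refine .whileDo (fun s' => s'.list = s.list ∧ s'.int n = s.int n ∧ s'.int m = s.int m ∧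
      1 ≤ s'.int i ∧ s'.int i ≤ 4 ∧ ∀ v, 1 ≤ v → v < s'.int i → entry [c1, c2, c3] v = s.int n)
    (fun s' => (4 - s'.int i).toNat)
    ⟨by simp, by simp, by simp, by simp, by simp, by simp; omega⟩ ?_
  rintro s' ⟨hl, hn, hm, h1, h4, hv⟩
  by_cases hc : s'.int i ≤ 3 ∧ entry [c1, c2, c3] (s'.int i) = s.int n
  · refine ⟨true, ?_, fun _ => ?_, by simp⟩
    · rw [eval_and, eval_eq, g s' i (s'.int i) hl (by simp) h1 hc.1, hc.2]
      simp [hn, hc.1]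
    · refine .assign (by simp; rfl) (.nil ?_)
      simp only [Store.setInt_list, Store.setInt_int, reduceCtorEq, if_false, if_true]
      refine ⟨⟨hl, hn, hm, by omega, by omega, fun v hv1 hv2 => ?_⟩, by omega⟩
      rcases (Int.lt_add_one_iff.1 hv2).lt_or_eq with h | h
      · exact hv v hv1 h
      · rw [h]; exact hc.2
  refine ⟨false, ?_, by simp, fun _ => ?_⟩
  · by_cases h3 : s'.int i ≤ 3
    · rw [eval_and, eval_eq, g s' i (s'.int i) hl (by simp) h1 h3]
      simpa [hn, h3] using hc
    · simp [h3]
  have hpos : ∀ {l : List ℤ}, (Function.update s.list S l) S = l := fun {l} => by simp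
  have hcases : s'.int i = 1 ∨ s'.int i = 2 ∨ s'.int i = 3 ∨ s'.int i = 4 := by omega
  rcases hcases with hi | hi | hi
  · have h1n : c1 ≠ s.int n := by simpa [hi, entry] using hc
    refine .ifThen (v := true) (by simp [hi]) (fun _ => ?_) (by simp)
    refine .assignEntry (z := 1) (by simp) le_rfl (by simp [hl, hS]) (y := c1 + 1)
      (by rw [eval_add, g s' 1 1 hl (by simp) (by simp) (by simp)]; simp [entry]) (.nil ?_)
    refine .ifThen (v := false) (by simp [hi]) (by simp) fun _ => ?_
    refine .ifThen (v := false) (by simp [hi]) (by simp) fun _ => ?_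
    refine h _ ?_ (by simp [hn]) (by simp [hm])
    simp [nextTriple, h1n, hl, hS]
  · have h1n : c1 = s.int n := by simpa [entry] using hv 1 le_rfl (by omega)
    have h2n : c2 ≠ s.int n := by simpa [hi, entry] using hc
    refine .ifThen (v := false) (by simp [hi]) (by simp) fun _ => ?_
    refine .ifThen (v := true) (by simp [hi]) (fun _ => ?_) (by simp)
    refine .assignEntry (z := 1) (by simp) le_rfl (by simp [hl, hS]) (y := c2 + 1)
      (by rw [eval_add, g s' 2 2 hl (by simp) (by simp) (by simp)]; simp [entry]) ?_
    refine .assignEntry (z := 2) (by simp) (by simp) (by simp [hl, hS]) (y := c2 + 1)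
      (by rw [eval_add, eval_get (z := 2) (by simp) (by simp) (by simp [hl, hS])]
          simp [entry, hl, hS]) (.nil ?_)
    refine .ifThen (v := false) (by simp [hi]) (by simp) fun _ => ?_
    refine h _ ?_ (by simp [hn]) (by simp [hm])
    simp [nextTriple, h1n, h2n, hl, hS]
  · have h1n : c1 = s.int n := by simpa [entry] using hv 1 le_rfl (by omega)
    have h2n : c2 = s.int n := by simpa [entry] using hv 2 (by simp) (by omega)
    refine .ifThen (v := false) (by rcases hi with hi | hi <;> simp [hi]) (by simp) fun _ => ?_
    refine .ifThen (v := false) (by rcases hi with hi | hi <;> simp [hi]) (by simp) fun _ => ?_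
    refine .ifThen (v := true) (by rcases hi with hi | hi <;> simp [hi]) (fun _ => ?_) (by simp)
    refine .assignEntry (z := 1) (by simp) le_rfl (by simp [hl, hS]) (y := 1) (by simp) ?_
    refine .assignEntry (z := 2) (by simp) (by simp) (by simp [hl, hS]) (y := 1) (by simp) ?_
    refine .assignEntry (z := 3) (by simp) (by simp) (by simp [hl, hS]) (y := c3 + 1)
      (by rw [eval_add, eval_get (z := 3) (by simp) (by simp) (by simp [hl, hS])]
          simp [entry, hl, hS]) (.nil ?_)
    refine h _ ?_ (by simp [hn]) (by simp [hm])
    simp [nextTriple, h1n, h2n, hl, hS]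

theorem Wp.ifSetOne {K : List Stmt} {Q : Store → Prop} {s : Store} {c : BoolExpr} {v : Bool}
    (hc : c.eval s = some v)
    (h : ∀ s' : Store, s'.list = s.list → s'.int n = s.int n →
      s'.int m = (if v then 1 else s.int m) → Wp K Q s') :
    Wp (.ifThen c [.assign m 1] :: K) Q s := by
  refine .ifThen hc (fun hv => .assign (eval_one s) (.nil (h _ rfl ?_ ?_))) fun hv => h _ rfl rfl ?_
    <;> simp [hv]

@[simp] theorem entry_cons_one (x : ℤ) (l : List ℤ) : entry (x :: l) 1 = x := rfl
@[simp] theorem entry_cons_two (x y : ℤ) (l : List ℤ) : entry (x :: y :: l) 2 = y := rfl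
@[simp] theorem entry_cons_three (x y z : ℤ) (l : List ℤ) : entry (x :: y :: z :: l) 3 = z := rfl

/-- The invariant `I` says that either a violated equation has been found, or all triples before the
current one, with `k` most significant, then `j`, then `i`, respect the equations. Only triples with
`j ≤ i` are visited. -/
theorem Wp.compareTuples {s : Store} (hn : s.int n = (s.list X).length) (hX : s.list X ≠ [])
    (hB : (s.list B).length = (s.list X).length) (hS : s.list S = [1, 1, 1]) (hm : s.int m = 0) :
    Wp [compareTuples] (fun s' => (∃ l, s'.list = Function.update s.list S l) ∧
      s'.int n = s.int n ∧ (s'.int m = 0 ∧ ListHom (s.list X) (s.list B) ∨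
        s'.int m = 1 ∧ ¬ ListHom (s.list X) (s.list B))) s := by
  rw [← List.length_pos_iff] at hX
  let I : Store → Prop := fun s' => ∃ i j k : ℤ,
    s'.list = Function.update s.list S [i, j, k] ∧ s'.int n = s.int n ∧
      1 ≤ j ∧ j ≤ i ∧ i ≤ s.int n ∧ 1 ≤ k ∧ (k ≤ s.int n ∨ k = s.int n + 1 ∧ i = 1 ∧ j = 1) ∧
      (s'.int m = 1 ∧ ¬ ListHom (s.list X) (s.list B) ∨ s'.int m = 0 ∧
        ∀ i' j' k', 1 ≤ j' → j' ≤ i' → i' ≤ s.int n → 1 ≤ k' →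
          (k' < k ∨ k' = k ∧ (j' < j ∨ j' = j ∧ i' < i)) →
            Respects (s.list X) (s.list B) i' j' k')
  -- The variant is a numeral in base `n + 1` with digits `n + 1 - k`, `n + 1 - j`, `n + 1 - i`, so
  -- it drops at each step of the enumeration of triples.
  let f : Store → ℕ := fun s' =>
    ((s.int n + 1 - entry (s'.list S) 3) * (s.int n + 1) ^ 2 +
      (s.int n + 1 - entry (s'.list S) 2) * (s.int n + 1) +
      (s.int n + 1 - entry (s'.list S) 1)).toNat
  -- The body is executed once before the loop and then inside it. It is named through an equation
  -- to avoid writing it out; `k ≠ n + 1` keeps the third index in range.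
  have hbody : ∀ s' : Store, I s' → s'.int m = 0 → entry (s'.list S) 3 ≠ s.int n + 1 →
      ∀ body c, MuPAD.compareTuples = .repeatUntil body c →
        Wp body (fun s'' => I s'' ∧ f s'' < f s') s' := by
    rintro s' ⟨c1, c2, c3, hl, hn', h1, h2, h3, h4, h5, h6⟩ hm' h7 body c hbc
    have h7' : c3 ≠ s.int n + 1 := by simpa [hl, entry] using h7
    have h8 : c3 ≤ s.int n := by omega
    have h9 := (h6.resolve_left (by omega)).2
    have gS : ∀ (s'' : Store) (a : IntExpr) (z : ℤ), s''.list = s'.list → a.eval s'' = some z →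
        1 ≤ z → z ≤ 3 → (IntExpr.get S a).eval s'' = some (entry [c1, c2, c3] z) := by
      intro s'' a z hl'' ha h1 h3
      rw [eval_get ha h1 (by rw [hl'', hl]; simpa using h3), hl'', hl, Function.update_self]
    have gX : ∀ (s'' : Store) (a : IntExpr) (z : ℤ), s''.list = s'.list → a.eval s'' = some z →
        1 ≤ z → z ≤ s.int n → (IntExpr.get X a).eval s'' = some (entry (s.list X) z) := by
      intro s'' a z hl'' ha h1 h3
      have : s'.list X = s.list X := by rw [hl]; simp
      rw [eval_get ha h1 (by rw [hl'', this]; omega), hl'', this]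
    have gB : ∀ (s'' : Store) (a : IntExpr) (z : ℤ), s''.list = s'.list → a.eval s'' = some z →
        1 ≤ z → z ≤ s.int n → (IntExpr.get B a).eval s'' = some (entry (s.list B) z) := by
      intro s'' a z hl'' ha h1 h3
      have : s'.list B = s.list B := by rw [hl]; simp
      rw [eval_get ha h1 (by rw [hl'', this]; omega), hl'', this]
    have e1 : ∀ s'' : Store, s''.list = s'.list → (IntExpr.get S 1).eval s'' = some c1 :=
      fun s'' h => by rw [gS s'' 1 1 h (by simp) (by simp) (by simp)]; simp [entry]
    have e2 : ∀ s'' : Store, s''.list = s'.list → (IntExpr.get S 2).eval s'' = some c2 :=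
      fun s'' h => by rw [gS s'' 2 2 h (by simp) (by simp) (by simp)]; simp [entry]
    have e3 : ∀ s'' : Store, s''.list = s'.list → (IntExpr.get S 3).eval s'' = some c3 :=
      fun s'' h => by rw [gS s'' 3 3 h (by simp) (by simp) (by simp)]; simp [entry]
    have x1 := fun s'' h => gX s'' _ c1 h (e1 s'' h) (by omega) (by omega)
    have x2 := fun s'' h => gX s'' _ c2 h (e2 s'' h) (by omega) (by omega)
    have x3 := fun s'' h => gX s'' _ c3 h (e3 s'' h) (by omega) (by omega)
    have b1 := fun s'' h => gB s'' _ c1 h (e1 s'' h) (by omega) (by omega)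
    have b2 := fun s'' h => gB s'' _ c2 h (e2 s'' h) (by omega) (by omega)
    have b3 := fun s'' h => gB s'' _ c3 h (e3 s'' h) (by omega) (by omega)
    simp only [MuPAD.compareTuples, Stmt.repeatUntil.injEq] at hbc
    obtain ⟨rfl, -⟩ := hbc
    have fin : ∀ s'' : Store, s''.list = s'.list → s''.int n = s.int n →
        (s''.int m = 0 ∧ Respects (s.list X) (s.list B) c1 c2 c3 ∨
          s''.int m = 1 ∧ ¬ Respects (s.list X) (s.list B) c1 c2 c3) → ∀ s3 : Store,
        s3.list = Function.update s''.list S (nextTriple (s''.int n) c1 c2 c3) →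
        s3.int n = s''.int n → s3.int m = s''.int m → I s3 ∧ f s3 < f s' := by
      intro s'' hl'' hn'' hm'' s3 hl3 hn3 hm3
      rw [hl'', hl, Function.update_idem] at hl3
      rw [hn''] at hn3 hl3
      have hnh : ¬ Respects (s.list X) (s.list B) c1 c2 c3 → ¬ ListHom (s.list X) (s.list B) :=
        fun h h' => h (h' c1 c2 c3 (by omega) (by omega) (by omega) (by omega) (by omega)
          (by omega))
      have hnn : 1 ≤ s.int n := by omega
      have hpos : 0 < (s.int n + 1 - entry [c1, c2, c3] 3) * (s.int n + 1) ^ 2 +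
          (s.int n + 1 - entry [c1, c2, c3] 2) * (s.int n + 1) +
          (s.int n + 1 - entry [c1, c2, c3] 1) := by
        simp only [entry_cons_one, entry_cons_two, entry_cons_three]
        have p1 := mul_nonneg (show 0 ≤ s.int n + 1 - c3 by omega) (sq_nonneg (s.int n + 1))
        have p2 := mul_nonneg (show 0 ≤ s.int n + 1 - c2 by omega) (show 0 ≤ s.int n + 1 by omega)
        omega
      simp only [I, f, hl, hl3, hm3, hn3, Function.update_self]
      unfold nextTriple
      split_ifs with hc1 hc2
      · refine ⟨⟨c1 + 1, c2, c3, rfl, trivial, by omega, by omega, by omega, by omega, by omega,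
          ?_⟩, ?_⟩
        · refine hm''.symm.imp (fun h => ⟨h.1, hnh h.2⟩) fun h => ⟨h.1, ?_⟩
          intro i' j' k' hj hji hi hk hlt
          by_cases he : k' = c3 ∧ j' = c2 ∧ i' = c1
          · obtain ⟨rfl, rfl, rfl⟩ := he; exact h.2
          · exact h9 i' j' k' hj hji hi hk (by omega)
        · refine (Int.toNat_lt_toNat hpos).2 ?_
          simp only [entry_cons_one, entry_cons_two, entry_cons_three]
          nlinarith
      · refine ⟨⟨c2 + 1, c2 + 1, c3, rfl, trivial, by omega, by omega, by omega, by omega, by omega,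
          ?_⟩,
          ?_⟩
        · refine hm''.symm.imp (fun h => ⟨h.1, hnh h.2⟩) fun h => ⟨h.1, ?_⟩
          intro i' j' k' hj hji hi hk hlt
          by_cases he : k' = c3 ∧ j' = c2 ∧ i' = c1
          · obtain ⟨rfl, rfl, rfl⟩ := he; exact h.2
          · exact h9 i' j' k' hj hji hi hk (by omega)
        · refine (Int.toNat_lt_toNat hpos).2 ?_
          simp only [entry_cons_one, entry_cons_two, entry_cons_three]
          nlinarith
      · refine ⟨⟨1, 1, c3 + 1, rfl, trivial, by omega, by omega, by omega, by omega, by omega,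
          ?_⟩, ?_⟩
        · refine hm''.symm.imp (fun h => ⟨h.1, hnh h.2⟩) fun h => ⟨h.1, ?_⟩
          intro i' j' k' hj hji hi hk hlt
          by_cases he : k' = c3 ∧ j' = c2 ∧ i' = c1
          · obtain ⟨rfl, rfl, rfl⟩ := he; exact h.2
          · exact h9 i' j' k' hj hji hi hk (by omega)
        · refine (Int.toNat_lt_toNat hpos).2 ?_
          simp only [entry_cons_one, entry_cons_two, entry_cons_three]
          nlinarith
    refine .ifSetOne (v := decide (entry (s.list X) c1 + entry (s.list X) c2 = entry (s.list X) c3 ∧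
      entry (s.list B) c1 + entry (s.list B) c2 ≠ entry (s.list B) c3)) ?_ fun s1 hl1 hn1 hm1 => ?_
    · rw [eval_and, eval_eq, eval_ne, eval_add, eval_add, x1 s' rfl, x2 s' rfl, x3 s' rfl,
        b1 s' rfl, b2 s' rfl, b3 s' rfl]
      by_cases h : entry (s.list X) c1 + entry (s.list X) c2 = entry (s.list X) c3 <;> simp [h]
    refine .ifSetOne (v := decide (entry (s.list X) c1 * entry (s.list X) c2 = entry (s.list X) c3 ∧
      entry (s.list B) c1 * entry (s.list B) c2 ≠ entry (s.list B) c3)) ?_ fun s2 hl2 hn2 hm2 => ?_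
    · rw [eval_and, eval_eq, eval_ne, eval_mul, eval_mul, x1 s1 hl1, x2 s1 hl1, x3 s1 hl1,
        b1 s1 hl1, b2 s1 hl1, b3 s1 hl1]
      by_cases h : entry (s.list X) c1 * entry (s.list X) c2 = entry (s.list X) c3 <;> simp [h]
    have hl2' : s2.list = s'.list := hl2.trans hl1
    have hn2' : s2.int n = s.int n := by rw [hn2, hn1, hn']
    refine .advance (c1 := c1) (c2 := c2) (c3 := c3) (by rw [hl2', hl, Function.update_self])
      fun s3 hl3 hn3 hm3 => .nil (fin s2 hl2' hn2' ?_ s3 hl3 hn3 hm3)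
    rw [hm1, hm'] at hm2
    simp only [decide_eq_true_eq] at hm2
    unfold Respects
    rw [hm2]
    clear * -
    split_ifs <;> simp <;> tauto
  have hI0 : I s := ⟨1, 1, 1, by rw [← hS, Function.update_eq_self], rfl, by omega, by omega,
    by omega, by omega, by omega, .inr ⟨hm, fun i' j' k' => by omega⟩⟩
  refine .repeatUntil ((hbody s hI0 hm (by simp [hS, entry]; omega) _ _ rfl).mono
    fun s1 hs1 => .whileDo I f hs1.1 fun s2 hs2 => ?_)
  obtain ⟨c1, c2, c3, hl, hn', h1, h2, h3, h4, h5, h6⟩ := id hs2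
  have hS3 : entry (s2.list S) 3 = c3 := by simp [hl, entry]
  have g3 : (IntExpr.get S 3).eval s2 = some c3 := by
    rw [eval_get (z := 3) (by simp) (by simp) (by simp [hl]), hS3]
  refine ⟨decide (¬ (c3 = s.int n + 1 ∨ s2.int m = 1)), ?_, fun hv => ?_, fun hv => ?_⟩
  · rw [eval_not, eval_or, eval_eq, g3]
    by_cases h : c3 = s.int n + 1 <;> simp [h, hn']
  · have hv := of_decide_eq_true hv
    push Not at hv
    exact hbody s2 hs2 (h6.resolve_left fun h => hv.2 h.1).1 (by rw [hS3]; exact hv.1) _ _ rfl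
  · have hv := of_decide_eq_false hv
    push Not at hv
    refine .nil ⟨⟨_, hl⟩, hn', ?_⟩
    rcases h6 with h6 | h6
    · exact .inr h6
    refine .inl ⟨h6.1, fun i j k hi hi' hj hj' hk hk' => ?_⟩
    -- Triples with `i < j` were not visited; they follow by commutativity.
    rcases le_total j i with h | h
    · exact h6.2 i j k hj h (by omega) hk (by omega)
    · simpa only [Respects, add_comm, mul_comm] using h6.2 j i k hi h (by omega) hk (by omega)

end MuPAD

namespace MuPAD

open IntVar ListVar

/-! ### The main loop -/

/-- There is a tuple of the same length with a larger entry that satisfies all additive and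
multiplicative equations of `l`. -/
def Extendable (l : List ℤ) : Prop :=
  ∃ l' : List ℤ, l'.length = l.length ∧ supAbs l < supAbs l' ∧ ListHom l l'

/-- The body of the loop that searches for a tuple `B` with the equations of `X`. -/
def searchBody : List Stmt :=
  [.assign m 0, .assignList S (.lit [1, 1, 1]), compareTuples, .assignList Y B] ++ nextTuple B

/-- The statements before the search. -/
def beforeSearch : List Stmt :=
  [.assign n (.nops X)] ++ countEquations ++
    [.ifThen (.lt 0 t) [.printList X],
      .assignList B (.lit []),
      .forDo t 1 n [.assignList B (.append B (-maxAbs X 1 - 1))]]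

/-- The statements from the search to the next tuple `X`. -/
def afterSearch : List Stmt :=
  countEquations ++ [.ifThen (.lt 0 t) [.printPair X Y]] ++ nextTuple X

/-- The condition for the transition to longer tuples. -/
def isLarge : BoolExpr := .lt (.pow 2 (.pow 2 n)) (maxAbs X 1)

/-- The statements that prepare the enumeration of longer tuples. -/
def lengthen : List Stmt :=
  [.assignList X (.lit []),
    .forDo t 1 (n + 1) [.assignList X (.append X (-1 - .pow 2 (.pow 2 n)))]]

/-- The main loop. -/
def mainLoop : Stmt :=
  .whileDo (.eq 0 0) (beforeSearch ++ [.repeatUntil searchBody (.eq m 0)] ++ afterSearch ++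
    [.ifThen isLarge (.print n :: lengthen)])

theorem code_eq : code = [.assignList X (.lit [-5, -5]), mainLoop] := rfl

/-- After a pass, `m` reports on the tuple that was tested, while `B` has already moved on to its
successor. -/
theorem Wp.searchBody {s : Store} (hn : s.int n = (s.list X).length) (hX : 2 ≤ (s.list X).length)
    (hB : (s.list B).length = (s.list X).length) :
    Wp searchBody (fun s' => s'.list X = s.list X ∧ s'.list B = nextList (s.list B) ∧
      s'.int n = s.int n ∧ (s'.int m = 0 ∧ ListHom (s.list X) (s.list B) ∨
        s'.int m = 1 ∧ ¬ ListHom (s.list X) (s.list B))) s := by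
  refine .assign (by simp; rfl) (.assignList (l := [1, 1, 1]) (by simp [ListExpr.eval]) (.cons ?_))
  refine (Wp.compareTuples (by simp [hn]) ?_ (by simp [hB]) (by simp) (by simp)).mono ?_
  · simp only [Store.setList_list, Store.setInt_list, ne_eq, reduceCtorEq, not_false_eq_true,
      Function.update_of_ne, ← List.length_pos_iff]
    omega
  rintro s1 ⟨⟨l, hl⟩, hn1, hm1⟩
  simp only [Store.setList_list, Store.setInt_list, Function.update_idem, Store.setList_int,
    Store.setInt_int, reduceCtorEq, if_false, ne_eq, not_false_eq_true,
    Function.update_of_ne] at hl hn1 hm1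
  have hB1 : s1.list B = s.list B := by simp [hl]
  have hX1 : s1.list X = s.list X := by simp [hl]
  refine .assignList (eval_listVar _ _) ?_
  refine (Wp.nextTuple B (by simp [hB1, hB, hX]) (by simp [hB1, hB, hn1, hn])).mono ?_
  rintro s2 ⟨hl2, hn2, hm2⟩
  refine ⟨by simp [hl2, hX1], by simp [hl2, hB1], by simp [hn2, hn1], ?_⟩
  rw [hm2]
  exact hm1

/-- Induction on the distance `j` from `B` to a known witness. The search may stop earlier at
another witness, hence the alternative `m = 0`. -/
theorem Wp.search_while {K : List Stmt} {Q : Store → Prop} {l : List ℤ} (hl : 2 ≤ l.length)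
    (h : ∀ s : Store, s.list X = l → s.int n = l.length → Wp K Q s) (j : ℕ) {s : Store}
    (hn : s.int n = l.length) (hX : s.list X = l) (hB : (s.list B).length = l.length)
    (hj : s.int m = 0 ∨ s.int m = 1 ∧ ListHom l (nextList^[j] (s.list B))) :
    Wp (.whileDo (.not (.eq m 0)) MuPAD.searchBody :: K) Q s := by
  induction j generalizing s with
  | zero =>
    rcases hj with hm | ⟨hm, hj⟩
    · exact .whileDo_false (by simp [hm]) (h s hX hn)
    refine .whileDo_true (by simp [hm]) ?_
    refine (Wp.searchBody (by rw [hn, hX]) (by rw [hX]; exact hl) (by rw [hB, hX])).mono ?_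
    rintro s' ⟨hX', -, hn', hm'⟩
    rw [hX] at hX' hm'
    have hm' := (hm'.resolve_right fun h => h.2 hj).1
    exact .whileDo_false (by simp [hm']) (h s' hX' (hn'.trans hn))
  | succ j ih =>
    rcases hj with hm | ⟨hm, hj⟩
    · exact .whileDo_false (by simp [hm]) (h s hX hn)
    refine .whileDo_true (by simp [hm]) ?_
    refine (Wp.searchBody (by rw [hn, hX]) (by rw [hX]; exact hl) (by rw [hB, hX])).mono ?_
    rintro s' ⟨hX', hB', hn', hm'⟩
    refine ih (hn'.trans hn) (hX'.trans hX) ?_ ?_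
    · rw [hB', length_nextList (by rw [← List.length_pos_iff]; omega), hB]
    · rw [hB', ← Function.iterate_succ_apply]
      exact hm'.imp (fun h => h.1) fun h => ⟨h.1, hj⟩

theorem Wp.beforeSearch {s : Store} (hX : 2 ≤ (s.list X).length) :
    Wp beforeSearch (fun s' => s'.list X = s.list X ∧ s'.int n = (s.list X).length ∧
      s'.list B = List.replicate (s.list X).length (-(supAbs (s.list X) + 1))) s := by
  refine .assign (eval_nops _ _) (.append ((Wp.countEquations (by simp)).mono ?_))
  rintro s1 ⟨hl1, hn1⟩
  simp only [Store.setInt_list, Store.setInt_int, if_true] at hl1 hn1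
  have key : ∀ s2 : Store, s2.list = s.list → s2.int n = (s.list X).length →
      Wp [.assignList B (.lit []), .forDo t 1 n [.assignList B (.append B (-maxAbs X 1 - 1))]]
        (fun s' => s'.list X = s.list X ∧ s'.int n = (s.list X).length ∧
          s'.list B = List.replicate (s.list X).length (-(supAbs (s.list X) + 1))) s2 := by
    intro s2 hl2 hn2
    refine .assignList (l := []) (by simp [ListExpr.eval]) ?_
    refine .forDo (lo := 1) (hi := (s.list X).length) (by simp) (by simp [hn2]) (by omega)
      (fun z s' => s'.list X = s.list X ∧ s'.int n = (s.list X).length ∧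
        s'.list B = List.replicate (z - 1).toNat (-(supAbs (s.list X) + 1)))
      (by simp [hl2, hn2]) ?_ ?_
    · rintro z s3 hz hz' h3 ⟨hX3, hn3, hB3⟩
      have hz1 : (z + 1 - 1).toNat = (z - 1).toNat + 1 := by omega
      refine .assignList (l := List.replicate (z + 1 - 1).toNat (-(supAbs (s.list X) + 1))) ?_
        (.nil ⟨by simp [h3], by simp [hX3], by simp [hn3], by simp⟩)
      rw [eval_append, eval_sub, eval_neg, eval_maxAbs (z := 1) (by simp) le_rfl
        (by rw [hX3]; omega) (by rw [hX3, hn3])]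
      simp only [eval_listVar, hB3, hX3, eval_one, Option.bind_some, sub_self, Int.toNat_zero,
        List.drop_zero]
      rw [hz1, List.replicate_succ', neg_add']
    · rintro s3 h3 ⟨hX3, hn3, hB3⟩
      exact .nil ⟨hX3, hn3, by rw [hB3]; congr 1; omega⟩
  refine .ifThen (v := decide (0 < s1.int t)) (by simp) (fun _ => ?_) fun _ => key s1 hl1 hn1
  exact .printList (eval_listVar _ _) (.nil (key s1 hl1 hn1))

theorem Wp.afterSearch {s : Store} (hX : 2 ≤ (s.list X).length)
    (hn : s.int n = (s.list X).length) :
    Wp afterSearch (fun s' => s'.list X = nextList (s.list X) ∧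
      s'.int n = (s.list X).length) s := by
  refine .append (.append ((Wp.countEquations hn).mono ?_))
  rintro s1 ⟨hl1, hn1⟩
  have key : Wp (MuPAD.nextTuple X) (fun s' => s'.list X = nextList (s.list X) ∧
      s'.int n = (s.list X).length) s1 := by
    refine (Wp.nextTuple X (by rw [hl1]; exact hX) (by rw [hl1, hn1, hn])).mono ?_
    rintro s2 ⟨hl2, hn2, -⟩
    exact ⟨by simp [hl2, hl1], by rw [hn2, hn1, hn]⟩
  refine .ifThen (v := decide (0 < s1.int t)) (by simp) (fun _ => ?_) fun _ => .nil key
  exact .printPair (eval_listVar _ _) (eval_listVar _ _) (.nil (.nil key))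

theorem eval_pow_two_pow_two {s : Store} {k : ℕ} (hn : s.int n = k) :
    (IntExpr.pow 2 (.pow 2 n)).eval s = some (2 ^ 2 ^ k) := by
  have h1 : (IntExpr.pow 2 n).eval s = some (2 ^ k) := by
    simp [IntExpr.eval, hn]
  have h2 : ((2 : ℤ) ^ k).toNat = 2 ^ k := by
    rw [← Int.toNat_natCast (2 ^ k)]; push_cast; rfl
  rw [IntExpr.eval, h1]
  simp [h2]

theorem eval_isLarge {s : Store} {k : ℕ} (hk : 1 ≤ k) (hn : s.int n = k)
    (hX : (s.list X).length = k) :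
    isLarge.eval s = some (decide (2 ^ 2 ^ k < supAbs (s.list X))) := by
  rw [isLarge, eval_lt, eval_pow_two_pow_two hn, eval_maxAbs (z := 1) (by simp) le_rfl
    (by omega) (by rw [hX, hn])]
  simp

theorem Wp.lengthen {s : Store} {k : ℕ} (hn : s.int n = k) :
    Wp lengthen (fun s' => s'.list X = List.replicate (k + 1) (-(2 ^ 2 ^ k + 1))) s := by
  refine .assignList (l := []) (by simp [ListExpr.eval]) ?_
  refine .forDo (lo := 1) (hi := k + 1) (by simp) (by simp [hn]) (by omega)
    (fun z s' => s'.int n = k ∧ s'.list X = List.replicate (z - 1).toNat (-(2 ^ 2 ^ k + 1)))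
    (by simp [hn]) ?_ ?_
  · rintro z s1 hz hz' h1 ⟨hn1, hX1⟩
    have hz1 : (z + 1 - 1).toNat = (z - 1).toNat + 1 := by omega
    refine .assignList (l := List.replicate (z + 1 - 1).toNat (-(2 ^ 2 ^ k + 1))) ?_
      (.nil ⟨by simp [h1], by simp [hn1], by simp⟩)
    rw [eval_append, eval_sub, eval_neg, eval_pow_two_pow_two hn1]
    simp only [eval_listVar, hX1, eval_one, Option.bind_some]
    rw [hz1, List.replicate_succ', neg_add_rev, ← sub_eq_add_neg]
  · rintro s1 h1 ⟨hn1, hX1⟩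
    exact .nil (by rw [hX1]; congr 1; omega)

/-- The main loop is about to be executed for the tuple `l`, and the integers in `z` have been
displayed. -/
def AtHead (l z : List ℤ) (c : State) : Prop :=
  ∃ s o, c = ⟨[mainLoop], s, o⟩ ∧ s.list X = l ∧ integersIn o = z

/-- A search without end goes on, and the integers in `z` have been displayed. -/
def Stuck (z : List ℤ) (c : State) : Prop :=
  integersIn c.output = z ∧ ∃ l K, c.todo = .whileDo (.not (.eq m 0)) searchBody :: K ∧
    2 ≤ l.length ∧ ¬ Extendable l ∧ c.store.list X = l ∧ c.store.int n = l.length ∧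
    (c.store.list B).length = l.length ∧ supAbs l < supAbs (c.store.list B) ∧ c.store.int m = 1

theorem mainLoop_step (s : Store) (o : List Item) :
    (State.mk [mainLoop] s o).step = some ⟨beforeSearch ++
      (.repeatUntil searchBody (.eq m 0) :: (afterSearch ++
        (.ifThen isLarge (.print n :: lengthen) :: [mainLoop]))), s, o⟩ := by
  rw [mainLoop, State.step]
  simp

theorem Wp.mainLoop_of_extendable {s : Store} (hX : 2 ≤ (s.list X).length)
    (h : Extendable (s.list X)) :
    Wp (MuPAD.beforeSearch ++ (.repeatUntil MuPAD.searchBody (.eq m 0) :: MuPAD.afterSearch))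
      (fun s' => s'.list X = nextList (s.list X) ∧ s'.int n = (s.list X).length) s := by
  obtain ⟨l', hlen, hlt, hhom⟩ := h
  have h0 := supAbs_nonneg (s.list X)
  refine .append ((Wp.beforeSearch hX).mono ?_)
  rintro s1 ⟨hX1, hn1, hB1⟩
  obtain ⟨j, hj⟩ := iterate_nextList_replicate (n := (s.list X).length) (by omega)
    (b := supAbs (s.list X) + 1) (by omega) hlen (by omega)
  rw [← hB1] at hj
  refine .repeatUntil ((Wp.searchBody (by rw [hn1, hX1]) (by rw [hX1]; exact hX)
    (by rw [hB1, hX1]; simp)).mono ?_)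
  rintro s2 ⟨hX2, hB2, hn2, hm2⟩
  rw [hX1] at hX2 hm2
  -- One candidate was tested by the first pass of the `repeat` loop, so `j - 1` successors remain.
  -- If `j = 0`, that candidate was the witness and the search is already over.
  refine Wp.search_while hX (fun s3 hX3 hn3 => ?_) (j - 1) (hn2.trans hn1) hX2 ?_ ?_
  · exact (Wp.afterSearch (by rw [hX3]; exact hX) (by rw [hX3, hn3])).mono
      fun s4 h4 => by rwa [hX3] at h4
  · rw [hB2, length_nextList, hB1, List.length_replicate]
    rw [hB1, ← List.length_pos_iff, List.length_replicate]
    omega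
  · refine hm2.imp (fun h => h.1) fun h => ⟨h.1, ?_⟩
    obtain _ | j := j
    · exact absurd (by rw [show s1.list B = l' from hj]; exact hhom) h.2
    · rw [hB2, ← Function.iterate_succ_apply, Nat.add_sub_cancel, hj]
      exact hhom

theorem AtHead.next {l z : List ℤ} {c : State} (hc : AtHead l z c) (hl : 2 ≤ l.length)
    (h : Extendable l) (hle : supAbs (nextList l) ≤ 2 ^ 2 ^ l.length) :
    ∃ d, Reaches c d ∧ AtHead (nextList l) z d := by
  obtain ⟨s, o, rfl, rfl, rfl⟩ := hc
  obtain ⟨s1, ⟨hX1, hn1⟩, h1⟩ := Wp.mainLoop_of_extendable hl h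
  obtain ⟨o', ho', hr⟩ := h1 (.ifThen isLarge (.print n :: lengthen) :: [mainLoop]) o
  have hX : s.list X ≠ [] := by rw [← List.length_pos_iff]; omega
  have h2 : isLarge.eval s1 = some false := by
    rw [eval_isLarge (k := (s.list X).length) (by omega) hn1 (by rw [hX1, length_nextList hX]),
      hX1]
    simpa using hle
  refine ⟨⟨[mainLoop], s1, o'⟩, ?_, s1, o', rfl, hX1, ho'⟩
  refine (Reaches.head (mainLoop_step s o) (by simpa using hr)).trans (Reaches.of_step ?_)
  simp [State.step, h2]

theorem AtHead.lengthen {l z : List ℤ} {c : State} (hc : AtHead l z c) (hl : 2 ≤ l.length)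
    (h : Extendable l) (hlt : 2 ^ 2 ^ l.length < supAbs (nextList l)) :
    ∃ d, Reaches c d ∧
      AtHead (List.replicate (l.length + 1) (-(2 ^ 2 ^ l.length + 1)))
        (z ++ [(l.length : ℤ)]) d := by
  obtain ⟨s, o, rfl, rfl, rfl⟩ := hc
  obtain ⟨s1, ⟨hX1, hn1⟩, h1⟩ := Wp.mainLoop_of_extendable hl h
  obtain ⟨o', ho', hr⟩ := h1 (.ifThen isLarge (.print n :: MuPAD.lengthen) :: [mainLoop]) o
  have hX : s.list X ≠ [] := by rw [← List.length_pos_iff]; omega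
  have h2 : isLarge.eval s1 = some true := by
    rw [eval_isLarge (k := (s.list X).length) (by omega) hn1 (by rw [hX1, length_nextList hX]),
      hX1]
    simpa using hlt
  obtain ⟨s2, hX2, h3⟩ := Wp.lengthen hn1
  obtain ⟨o'', ho'', hr'⟩ := h3 [mainLoop] (o' ++ [.int (s.list X).length])
  refine ⟨⟨[mainLoop], s2, o''⟩, ?_, s2, o'', rfl, hX2, ?_⟩
  · refine (Reaches.head (mainLoop_step s o) (by simpa using hr)).trans ?_
    refine Reaches.head (d := ⟨.print n :: (MuPAD.lengthen ++ [mainLoop]), s1, o'⟩) ?_ ?_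
    · simp [State.step, h2]
    · exact Reaches.head (by simp [State.step, hn1]) hr'
  · rw [ho'', integersIn_append, ho']
    rfl

theorem AtHead.stuck {l z : List ℤ} {c : State} (hc : AtHead l z c) (hl : 2 ≤ l.length)
    (h : ¬ Extendable l) : ∃ d, Reaches c d ∧ Stuck z d := by
  obtain ⟨s, o, rfl, rfl, rfl⟩ := hc
  have h0 := supAbs_nonneg (s.list X)
  obtain ⟨s1, ⟨hX1, hn1, hB1⟩, h1⟩ := Wp.beforeSearch hl
  obtain ⟨o1, ho1, hr1⟩ := h1 (.repeatUntil searchBody (.eq m 0) :: (afterSearch ++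
        (.ifThen isLarge (.print n :: MuPAD.lengthen) :: [mainLoop]))) o
  have hlen1 : (s1.list B).length = (s.list X).length := by rw [hB1, List.length_replicate]
  have hne1 : s1.list B ≠ [] := by rw [← List.length_pos_iff]; omega
  have hlt1 : supAbs (s.list X) < supAbs (s1.list B) := by
    rw [hB1, supAbs_replicate (by omega), abs_neg, abs_of_nonneg (by omega)]
    omega
  obtain ⟨s2, ⟨hX2, hB2, hn2, hm2⟩, h2⟩ := Wp.searchBody (s := s1) (by rw [hn1, hX1])
    (by rw [hX1]; exact hl) (by rw [hlen1, hX1])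
  obtain ⟨o2, ho2, hr2⟩ := h2 (.whileDo (.not (.eq m 0)) searchBody :: (afterSearch ++
        (.ifThen isLarge (.print n :: MuPAD.lengthen) :: [mainLoop]))) o1
  refine ⟨_, (Reaches.head (mainLoop_step s o) hr1).trans (Reaches.head rfl hr2),
    ho2.trans ho1, s.list X, _, rfl, hl, h, hX2.trans hX1, hn2.trans hn1, ?_, ?_, ?_⟩
  · simp only [hB2, length_nextList hne1, hlen1]
  · simp only [hB2]
    exact hlt1.trans_le (supAbs_le_supAbs_nextList hne1)
  · rw [hX1] at hm2
    exact (hm2.resolve_left fun h' => h ⟨_, hlen1, hlt1, h'.2⟩).1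

/-- Maxima never decrease along the enumeration, so every candidate `B` is larger than `X`. As `X`
is not extendable, each candidate violates an equation of `X` and `m` becomes `1` again. -/
theorem Stuck.recurrent {z : List ℤ} (c : State) (hc : Stuck z c) :
    ∃ k d, c.after (k + 1) = some d ∧ Stuck z d := by
  obtain ⟨todo, s1, o⟩ := c
  obtain ⟨rfl, l, K, rfl, hl, h, hX1, hn1, hlen1, hlt1, hm1⟩ := hc
  simp only at hX1 hn1 hlen1 hlt1 hm1
  have hne1 : s1.list B ≠ [] := by rw [← List.length_pos_iff]; omega
  obtain ⟨s2, ⟨hX2, hB2, hn2, hm2⟩, h2⟩ := Wp.searchBody (s := s1) (by rw [hn1, hX1])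
    (by rw [hX1]; exact hl) (by rw [hlen1, hX1])
  obtain ⟨o2, ho2, k, hk⟩ := h2 (.whileDo (.not (.eq m 0)) searchBody :: K) o
  refine ⟨k, ⟨_, s2, o2⟩, ?_, ho2, l, K, rfl, hl, h, hX2.trans hX1, hn2.trans hn1, ?_, ?_, ?_⟩
  · rw [add_comm, State.after_add]
    have : (State.mk (.whileDo (.not (.eq m 0)) searchBody :: K) s1 o).after 1 =
        some ⟨searchBody ++ .whileDo (.not (.eq m 0)) searchBody :: K, s1, o⟩ := by
      simp [State.after, State.step, hm1]
    rw [this]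
    exact hk
  · simp only [hB2, length_nextList hne1, hlen1]
  · simp only [hB2]
    exact hlt1.trans_le (supAbs_le_supAbs_nextList hne1)
  · rw [hX1] at hm2
    exact (hm2.resolve_left fun h' => h ⟨_, hlen1, hlt1, h'.2⟩).1

/-! ### Processing all tuples of one length -/

/-- The search succeeds for all tuples of length `n` that the program considers. -/
def SearchSucceeds (n : ℕ) : Prop :=
  ∀ l : List ℤ, l.length = n → 2 ^ 2 ^ (n - 1) < supAbs l → supAbs l ≤ 2 ^ 2 ^ n → Extendable l

/-- The first tuple of length `n` that the program considers. -/
def firstTuple (n : ℕ) : List ℤ := List.replicate n (-(2 ^ 2 ^ (n - 1) + 1))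

theorem AtHead.iterate {n : ℕ} (hn : 2 ≤ n) {z : List ℤ} {c : State}
    (hc : AtHead (firstTuple n) z c) (j : ℕ)
    (hj : ∀ i < j, Extendable (nextList^[i] (firstTuple n)))
    (hle : supAbs (nextList^[j] (firstTuple n)) ≤ 2 ^ 2 ^ n) :
    ∃ d, Reaches c d ∧ AtHead (nextList^[j] (firstTuple n)) z d := by
  have hne : firstTuple n ≠ [] := by simp [firstTuple]; omega
  have hlen : ∀ i, (nextList^[i] (firstTuple n)).length = n := fun i => by
    rw [length_iterate_nextList hne]; simp [firstTuple]
  induction j with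
  | zero => exact ⟨c, .refl c, hc⟩
  | succ j ih =>
    obtain ⟨d, hd, hd'⟩ := ih (fun i hi => hj i (by omega))
      ((monotone_supAbs_iterate_nextList hne j.le_succ).trans hle)
    rw [Function.iterate_succ_apply'] at hle ⊢
    obtain ⟨e, he, he'⟩ := hd'.next (by rw [hlen]; exact hn) (hj j (by omega)) (by rwa [hlen])
    exact ⟨e, hd.trans he, he'⟩

theorem supAbs_firstTuple {n : ℕ} (hn : n ≠ 0) : supAbs (firstTuple n) = 2 ^ 2 ^ (n - 1) + 1 := by
  rw [firstTuple, supAbs_replicate hn, abs_neg, abs_of_nonneg (by positivity)]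

theorem AtHead.of_searchSucceeds {n : ℕ} (hn : 2 ≤ n) {z : List ℤ} {c : State}
    (hc : AtHead (firstTuple n) z c) (h : SearchSucceeds n) :
    ∃ d, Reaches c d ∧ AtHead (firstTuple (n + 1)) (z ++ [(n : ℤ)]) d := by
  have hne : firstTuple n ≠ [] := by simp [firstTuple]; omega
  have hlen : ∀ i, (nextList^[i] (firstTuple n)).length = n := fun i => by
    rw [length_iterate_nextList hne]; simp [firstTuple]
  have hmono := monotone_supAbs_iterate_nextList hne
  have h0 := supAbs_firstTuple (n := n) (by omega)
  have hpow : (2 : ℤ) ^ 2 ^ (n - 1) < 2 ^ 2 ^ n :=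
    pow_lt_pow_right₀ (by norm_num) (Nat.pow_lt_pow_right (by norm_num) (by omega))
  -- The enumeration leaves the window, since it reaches the tuple with all entries `2 ^ 2 ^ n + 1`.
  have hex : ∃ j, 2 ^ 2 ^ n < supAbs (nextList^[j] (firstTuple n)) := by
    have h1 : supAbs (List.replicate n (2 ^ 2 ^ n + 1 : ℤ)) = 2 ^ 2 ^ n + 1 := by
      rw [supAbs_replicate (by omega), abs_of_nonneg (by positivity)]
    obtain ⟨j, hj⟩ := iterate_nextList_replicate (n := n) (by omega)
      (b := 2 ^ 2 ^ (n - 1) + 1) (by positivity) (l := List.replicate n (2 ^ 2 ^ n + 1))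
      (by simp) (by rw [h1]; omega)
    exact ⟨j, by rw [firstTuple, hj, h1]; omega⟩
  classical
  -- At the least such `j`, the predecessor is the last tuple of length `n` at the head of the main
  -- loop. The case `j = 0` cannot occur, because the first tuple lies in the window.
  obtain ⟨j, hj, hmin⟩ : ∃ j, 2 ^ 2 ^ n < supAbs (nextList^[j] (firstTuple n)) ∧
      ∀ i < j, supAbs (nextList^[i] (firstTuple n)) ≤ 2 ^ 2 ^ n :=
    ⟨Nat.find hex, Nat.find_spec hex, fun i hi => not_lt.1 (Nat.find_min hex hi)⟩
  obtain _ | j := j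
  · simp only [Function.iterate_zero, id_eq, h0] at hj
    omega
  have hext : ∀ i < j + 1, Extendable (nextList^[i] (firstTuple n)) := fun i hi => by
    refine h _ (hlen i) ?_ (hmin i hi)
    have := hmono (Nat.zero_le i)
    simp only [Function.iterate_zero, id_eq, h0] at this
    omega
  obtain ⟨d, hd, hd'⟩ := hc.iterate hn j (fun i hi => hext i (by omega)) (hmin j (by omega))
  rw [Function.iterate_succ_apply'] at hj
  obtain ⟨e, he, he'⟩ := hd'.lengthen (by rw [hlen]; exact hn) (hext j (by omega))
    (by rwa [hlen])
  rw [hlen] at he'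
  exact ⟨e, hd.trans he, he'⟩

theorem AtHead.of_not_searchSucceeds {n : ℕ} (hn : 2 ≤ n) {z : List ℤ} {c : State}
    (hc : AtHead (firstTuple n) z c) (h : ¬ SearchSucceeds n) :
    ∃ d, Reaches c d ∧ Stuck z d := by
  have hne : firstTuple n ≠ [] := by simp [firstTuple]; omega
  have hlen : ∀ i, (nextList^[i] (firstTuple n)).length = n := fun i => by
    rw [length_iterate_nextList hne]; simp [firstTuple]
  have hex : ∃ j, ¬ Extendable (nextList^[j] (firstTuple n)) ∧
      supAbs (nextList^[j] (firstTuple n)) ≤ 2 ^ 2 ^ n := by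
    simp only [SearchSucceeds, not_forall] at h
    obtain ⟨l, hl, hlt, hle, hl'⟩ := h
    obtain ⟨j, hj⟩ := iterate_nextList_replicate (n := n) (by omega)
      (b := 2 ^ 2 ^ (n - 1) + 1) (by positivity) hl (by omega)
    exact ⟨j, by rw [firstTuple, hj]; exact ⟨hl', hle⟩⟩
  classical
  obtain ⟨j, hj, hmin⟩ : ∃ j, (¬ Extendable (nextList^[j] (firstTuple n)) ∧
      supAbs (nextList^[j] (firstTuple n)) ≤ 2 ^ 2 ^ n) ∧
      ∀ i < j, Extendable (nextList^[i] (firstTuple n)) := by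
    refine ⟨Nat.find hex, Nat.find_spec hex, fun i hi => ?_⟩
    -- By monotonicity of the maxima, an earlier non-extendable tuple would also respect the upper
    -- bound, against minimality.
    by_contra hi'
    exact Nat.find_min hex hi ⟨hi', (monotone_supAbs_iterate_nextList hne hi.le).trans
      (Nat.find_spec hex).2⟩
  obtain ⟨d, hd, hd'⟩ := hc.iterate hn j hmin hj.2
  obtain ⟨e, he, he'⟩ := hd'.stuck (by rw [hlen]; exact hn) hj.1
  exact ⟨e, hd.trans he, he'⟩

end MuPAD

/-! ### Systems of at most three unknowns -/

/-- The tuple `y` satisfies all additive and multiplicative equations of the tuple `x`. -/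
def Preserves {ι : Type*} (x y : ι → ℤ) : Prop :=
  ∀ i j k, (x i + x j = x k → y i + y j = y k) ∧ (x i * x j = x k → y i * y j = y k)

theorem eq_zero_or_one_of_mul_eq_right {a b : ℤ} (h : a * b = b) : b = 0 ∨ a = 1 := by
  rcases eq_or_ne b 0 with hb | hb
  · exact .inl hb
  · exact .inr (by simpa [hb] using h)

/-- By size, the nontrivial equations between such `a` and `b` reduce to `b = 0`, `b = 1`, `a = 2b`
and `a = b²`. -/
theorem preserves_pair {a b x y : ℤ} (hab : |b| ≤ |a|) (ha : 4 < |a|)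
    (h0 : b = 0 → y = 0) (h1 : b = 1 → y = 1) (h2 : a = 2 * b → x = 2 * y)
    (h3 : a = b * b → x = y * y) : Preserves ![a, b] ![x, y] := by
  have ca := abs_choice a
  have cb := abs_choice b
  have na := abs_nonneg a
  have nb := abs_nonneg b
  have ha0 : a ≠ 0 := by rintro rfl; simp at ha
  have haa : 5 * |a| ≤ a * a := by rw [← abs_mul_abs_self a]; nlinarith
  have f1 : a * b = a → b = 1 := fun h => by
    simpa [ha0] using h
  have f2 : a * b = b → b = 0 := fun h =>
    (eq_zero_or_one_of_mul_eq_right h).resolve_right (by rintro rfl; simp at ha)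
  have f3 : b * b = b → b = 0 ∨ b = 1 := eq_zero_or_one_of_mul_eq_right
  intro i j k
  fin_cases i <;> fin_cases j <;> fin_cases k <;>
    simp only [Fin.zero_eta, Fin.mk_one, Fin.isValue, Matrix.cons_val_zero, Matrix.cons_val_one,
      Matrix.cons_val_fin_one, mul_comm b a, mul_comm y x] <;>
    refine ⟨fun h => by omega, fun h => ?_⟩
  · omega
  · omega
  · simp [h1 (f1 h)]
  · simp [h0 (f2 h)]
  · simp [h1 (f1 h)]
  · simp [h0 (f2 h)]
  · exact (h3 h.symm).symm
  · rcases f3 h with h | h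
    · simp [h0 h]
    · simp [h1 h]

theorem exists_preserves_pair {a b : ℤ} (hab : |b| ≤ |a|) (ha : 4 < |a|) :
    ∃ x y : ℤ, Preserves ![a, b] ![x, y] ∧ (|a| < |x| ∨ |a| < |y|) := by
  have ca := abs_choice a
  have cb := abs_choice b
  have na := abs_nonneg a
  have nb := abs_nonneg b
  obtain ⟨T, hT⟩ : ∃ T, |a| < |T| := ⟨|a| + 1, (lt_add_one _).trans_le (le_abs_self _)⟩
  by_cases h2 : a = 2 * b
  · refine ⟨2 * T, T, preserves_pair hab ha (by omega) (by omega) (fun _ => rfl) fun h => ?_,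
      .inr hT⟩
    -- Both `a = 2b` and `a = b²` hold only for `(4, 2)`, which `4 < |a|` excludes.
    have : b = 2 := by
      have hb : b ≠ 0 := by omega
      exact mul_right_cancel₀ hb (by rw [← h, h2])
    omega
  by_cases h3 : a = b * b
  · refine ⟨T * T, T, preserves_pair hab ha ?_ ?_ (fun h => absurd h h2) fun _ => rfl, .inr hT⟩
    · rintro rfl; omega
    · rintro rfl; omega
  exact ⟨T, b, preserves_pair hab ha id id (fun h => absurd h h2) (fun h => absurd h h3), .inl hT⟩

/-- The implications that are relevant for `Preserves ![a, b, c] ![x, y, z]`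
if `|c| ≤ |b| ≤ |a|` and `16 < |a|`. -/
structure PreservesTriple (a b c x y z : ℤ) : Prop where
  c_zero : c = 0 → z = 0
  c_one : c = 1 → z = 1
  b_zero : b = 0 → y = 0
  b_one : b = 1 → y = 1
  sub_b : a = c - b → x = z - y
  sub_c : a = b - c → x = y - z
  two_b : a = 2 * b → x = 2 * y
  add : a = b + c → x = y + z
  two_c : a = 2 * c → x = 2 * z
  b_two_c : b = 2 * c → y = 2 * z
  b_sq : a = b * b → x = y * y
  mul : a = b * c → x = y * z
  c_sq : a = c * c → x = z * z
  b_c_sq : b = c * c → y = z * z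
  b_mul : b = a * c → y = x * z
  c_b_sq : c = b * b → z = y * y

/-- Size excludes the equations absent from `PreservesTriple`, or reduces them to an entry being `0`
or `1`. For instance, `a * b = c` forces `b = 0`. -/
theorem PreservesTriple.preserves {a b c x y z : ℤ} (h : PreservesTriple a b c x y z)
    (hab : |b| ≤ |a|) (hbc : |c| ≤ |b|) (ha : 16 < |a|) :
    Preserves ![a, b, c] ![x, y, z] := by
  have ha0 : a ≠ 0 := by rintro rfl; simp at ha
  have ha1 : a ≠ 1 := by rintro rfl; simp at ha
  have haa : 17 * |a| ≤ a * a := by rw [← abs_mul_abs_self a]; nlinarith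
  have fa : ∀ {d : ℤ}, a * d = a → d = 1 := fun h => by simpa [ha0] using h
  have fd : ∀ {d : ℤ}, a * d = d → d = 0 := fun h =>
    (eq_zero_or_one_of_mul_eq_right h).resolve_right ha1
  have fc : a * b = c → b = 0 := fun h => by
    by_contra hb
    have hb' := Int.one_le_abs hb
    have h' : |a| * |b| = |c| := by rw [← abs_mul, h]
    nlinarith
  have naa : ∀ {d : ℤ} {p : Prop}, |d| ≤ |a| → a * a = d → p := fun {d} p h h' => by
    have := le_abs_self d
    omega
  have saa : ∀ {d : ℤ} {p : Prop}, |d| ≤ |a| → a + a = d → p := fun {d} p h h' => by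
    rw [← h', ← two_mul, abs_mul, abs_two] at h
    omega
  have sbb : b + b = c → b = 0 := fun h => by
    rw [← h, ← two_mul, abs_mul, abs_two] at hbc
    exact abs_eq_zero.1 (le_antisymm (by omega) (abs_nonneg b))
  have sab : a + b = a → x + y = x := fun e => by rw [h.b_zero (by omega), add_zero]
  have sac : a + c = a → x + z = x := fun e => by rw [h.c_zero (by omega), add_zero]
  have sab' : ∀ {d : ℤ} {p : Prop}, a + d = d → p := fun e => absurd e (by omega)
  have sbb' : b + b = c → y + y = z := fun e => by
    have hb := sbb e
    rw [h.b_zero hb, h.c_zero (by rw [← e, hb, add_zero]), add_zero]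
  have sbb'' : b + b = b → y + y = y := fun e => by rw [h.b_zero (by omega), add_zero]
  have scc : c + c = c → z + z = z := fun e => by rw [h.c_zero (by omega), add_zero]
  have sbc : b + c = b → y + z = y := fun e => by rw [h.c_zero (by omega), add_zero]
  have sbc' : b + c = c → y + z = z := fun e => by rw [h.b_zero (by omega), zero_add]
  have sub_b : a + b = c → x + y = z := fun e => by rw [h.sub_b (by omega), sub_add_cancel]
  have sub_c : a + c = b → x + z = y := fun e => by rw [h.sub_c (by omega), sub_add_cancel]
  have two_b : b + b = a → y + y = x := fun e => by rw [h.two_b (by omega), two_mul]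
  have two_c : c + c = a → z + z = x := fun e => by rw [h.two_c (by omega), two_mul]
  have b_two_c : c + c = b → z + z = y := fun e => by rw [h.b_two_c (by omega), two_mul]
  have pab : a * b = a → x * y = x := fun e => by rw [h.b_one (fa e), mul_one]
  have pab' : a * b = b → x * y = y := fun e => by rw [h.b_zero (fd e), mul_zero]
  have pab'' : a * b = c → x * y = z := fun e => by
    have hb := fc e
    rw [hb, mul_zero] at e
    rw [h.b_zero hb, h.c_zero e.symm, mul_zero]
  have pac : a * c = a → x * z = x := fun e => by rw [h.c_one (fa e), mul_one]
  have pac' : a * c = c → x * z = z := fun e => by rw [h.c_zero (fd e), mul_zero]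
  have pbb : b * b = b → y * y = y := fun e => by
    rcases eq_zero_or_one_of_mul_eq_right e with e | e
    · rw [h.b_zero e, mul_zero]
    · rw [h.b_one e, mul_one]
  have pcc : c * c = c → z * z = z := fun e => by
    rcases eq_zero_or_one_of_mul_eq_right e with e | e
    · rw [h.c_zero e, mul_zero]
    · rw [h.c_one e, mul_one]
  have pbc : b * c = b → y * z = y := fun e => by
    rw [mul_comm] at e
    rcases eq_zero_or_one_of_mul_eq_right e with e | e
    · rw [h.b_zero e, zero_mul]
    · rw [h.c_one e, mul_one]
  have pbc' : b * c = c → y * z = z := fun e => by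
    rcases eq_zero_or_one_of_mul_eq_right e with e | e
    · rw [h.c_zero e, mul_zero]
    · rw [h.b_one e, one_mul]
  have hca := hbc.trans hab
  intro i j k
  fin_cases i <;> fin_cases j <;> fin_cases k <;>
    simp only [Fin.zero_eta, Fin.mk_one, Fin.isValue, Matrix.cons_val_zero, Matrix.cons_val_one,
      Matrix.cons_val_two, Matrix.tail_cons, Matrix.head_cons, Fin.reduceFinMk,
      mul_comm b a, mul_comm y x, mul_comm c a, mul_comm z x, mul_comm c b, mul_comm z y,
      add_comm b a, add_comm y x, add_comm c a, add_comm z x, add_comm c b, add_comm z y]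
  -- Each group of three belongs to one pair of positions on the left-hand side; within it the
  -- right-hand side runs through the first, second and third entry.
  exacts [⟨saa le_rfl, naa le_rfl⟩, ⟨saa hab, naa hab⟩, ⟨saa hca, naa hca⟩,
    ⟨sab, pab⟩, ⟨sab', pab'⟩, ⟨sub_b, pab''⟩,
    ⟨sac, pac⟩, ⟨sub_c, fun e => (h.b_mul e.symm).symm⟩, ⟨sab', pac'⟩,
    ⟨sab, pab⟩, ⟨sab', pab'⟩, ⟨sub_b, pab''⟩,
    ⟨two_b, fun e => (h.b_sq e.symm).symm⟩, ⟨sbb'', pbb⟩, ⟨sbb', fun e => (h.c_b_sq e.symm).symm⟩,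
    ⟨fun e => (h.add e.symm).symm, fun e => (h.mul e.symm).symm⟩, ⟨sbc, pbc⟩, ⟨sbc', pbc'⟩,
    ⟨sac, pac⟩, ⟨sub_c, fun e => (h.b_mul e.symm).symm⟩, ⟨sab', pac'⟩,
    ⟨fun e => (h.add e.symm).symm, fun e => (h.mul e.symm).symm⟩, ⟨sbc, pbc⟩, ⟨sbc', pbc'⟩,
    ⟨two_c, fun e => (h.c_sq e.symm).symm⟩, ⟨b_two_c, fun e => (h.b_c_sq e.symm).symm⟩, ⟨scc, pcc⟩]

/-- The estimate for `2 * T` serves the family with `a = c² = 2b`, where the third entry has to be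
even. -/
theorem exists_large_int (a : ℤ) : ∃ T : ℤ, |a| < |T| ∧ |a| < |2 * T| :=
  ⟨|a| + 1, (lt_add_one _).trans_le (le_abs_self _),
    lt_of_lt_of_le (by have := abs_nonneg a; omega) (le_abs_self (2 * (|a| + 1)))⟩

/-- Here `c` is `0`, `1` or `-1` and is kept. A relation expressing `a` by `b` and `c` gives a
family with free parameter `y = T`; without one, `a` alone can be moved. -/
theorem exists_preservesTriple_of_abs_le_one {a b c : ℤ} (hab : |b| ≤ |a|) (ha : 16 < |a|)
    (hc : |c| ≤ 1) :
    ∃ x y z : ℤ, PreservesTriple a b c x y z ∧ (|a| < |x| ∨ |a| < |y| ∨ |a| < |z|) := by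
  obtain ⟨T, hT, -⟩ := exists_large_int a
  have sx : ∀ y z : ℤ, |a| < |T| ∨ |a| < |y| ∨ |a| < |z| := fun _ _ => .inl hT
  have sy : ∀ x z : ℤ, |a| < |x| ∨ |a| < |T| ∨ |a| < |z| := fun _ _ => .inr (.inl hT)
  have hc' : c = 0 ∨ c = 1 ∨ c = -1 := by
    have := abs_le.1 hc
    omega
  have hbb : |b| * |b| = b * b := abs_mul_abs_self b
  have hb0 := mul_self_nonneg b
  have hba : a = b * b → 5 ≤ |b| ∧ 5 * |b| ≤ b * b := fun h => by
    rw [h, abs_of_nonneg hb0] at ha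
    have h5 : 5 ≤ |b| := by
      by_contra! h5
      nlinarith [abs_nonneg b]
    exact ⟨h5, by nlinarith⟩
  have hcb : c = b * b → |b| ≤ 1 := fun h => by
    by_contra! h5
    have := le_abs_self c
    nlinarith
  have ca := abs_choice a
  have cb := abs_choice b
  have na := abs_nonneg a
  have nb := abs_nonneg b
  by_cases h5 : a = c - b
  · refine ⟨c - T, T, c, ?_, sy _ _⟩
    rcases hc' with rfl | rfl | rfl <;> constructor <;> intro h <;>
      first | ring1 | (exfalso; omega)
  by_cases h6 : a = b - c
  · refine ⟨T - c, T, c, ?_, sy _ _⟩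
    rcases hc' with rfl | rfl | rfl <;> constructor <;> intro h <;>
      first | ring1 | (exfalso; omega)
  by_cases h7 : a = 2 * b
  · refine ⟨2 * T, T, c, ?_, sy _ _⟩
    rcases hc' with rfl | rfl | rfl <;> constructor <;> intro h <;>
      first | ring1 | (exfalso; omega)
  by_cases h8 : a = b + c
  · refine ⟨T + c, T, c, ?_, sy _ _⟩
    rcases hc' with rfl | rfl | rfl <;> constructor <;> intro h <;>
      first | ring1 | (exfalso; omega)
  by_cases h11 : a = b * b
  · obtain ⟨hb5, hbb5⟩ := hba h11
    refine ⟨T * T, T, c, ?_, sy _ _⟩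
    rcases hc' with rfl | rfl | rfl <;> constructor <;> intro h <;>
      first | ring1 | (exfalso; omega)
  by_cases h12 : a = b * c
  · refine ⟨T * c, T, c, ?_, sy _ _⟩
    rcases hc' with rfl | rfl | rfl <;> constructor <;> intro h <;>
      first | ring1 | (exfalso; omega)
  · refine ⟨T, b, c, ?_, sx _ _⟩
    rcases hc' with rfl | rfl | rfl <;> constructor <;> intro h <;>
      first | exact h | (exfalso; omega) | omega

/-- Since `b²` is much larger than `|b|`, no linear relation involves `a`. What remains is how `b`
depends on `c`: `2c`, `c²`, `±c` or not at all. The relations `b = 2c` and `b = c²` together give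
`(16, 4, 2)`, the triple that makes the bound `16` sharp. -/
theorem exists_preservesTriple_of_b_sq {a b c : ℤ} (hbc : |c| ≤ |b|) (ha : 16 < |a|)
    (hc : 2 ≤ |c|) (h11 : a = b * b) :
    ∃ x y z : ℤ, PreservesTriple a b c x y z ∧ (|a| < |x| ∨ |a| < |y| ∨ |a| < |z|) := by
  obtain ⟨T, hT, -⟩ := exists_large_int a
  have sy : ∀ x z : ℤ, |a| < |x| ∨ |a| < |T| ∨ |a| < |z| := fun _ _ => .inr (.inl hT)
  have sz : ∀ x y : ℤ, |a| < |x| ∨ |a| < |y| ∨ |a| < |T| := fun _ _ => .inr (.inr hT)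
  have hbb : |b| * |b| = b * b := abs_mul_abs_self b
  have hcc : |c| * |c| = c * c := abs_mul_abs_self c
  rw [h11, abs_of_nonneg (mul_self_nonneg b)] at ha
  have hb5 : 5 ≤ |b| := by
    by_contra! h5
    nlinarith
  have hbb5 : 5 * |b| ≤ b * b := by nlinarith
  have hbac : b ≠ a * c := fun h => by
    have h' : |b| = |a| * |c| := by rw [← abs_mul, ← h]
    rw [h11, abs_of_nonneg (mul_self_nonneg b)] at h'
    nlinarith
  have hb0 : b ≠ 0 := by rintro rfl; simp at hb5
  have hc0 : c ≠ 0 := by rintro rfl; simp at hc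
  have r7 : b ≠ c → a ≠ b * c := fun hne h => hne (mul_left_cancel₀ hb0 (by rw [← h11, h]))
  have r8 : b ≠ c → b ≠ -c → a ≠ c * c := fun hne hne' h =>
    (mul_self_eq_mul_self_iff.1 (by rw [← h11, h])).elim hne hne'
  have ca := abs_choice a
  have cb := abs_choice b
  have cc := abs_choice c
  by_cases h10 : b = 2 * c
  · have := r7 (by omega)
    have := r8 (by omega) (by omega)
    have : b ≠ c * c := fun h => by
      have : c = 2 := mul_right_cancel₀ hc0 (by rw [← h10, h])
      omega
    clear r7 r8
    refine ⟨4 * (T * T), 2 * T, T, ?_, sz _ _⟩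
    constructor <;> intro h <;> first | ring1 | (exfalso; omega)
  by_cases h14 : b = c * c
  · have hcb : 2 * |c| ≤ |b| := by rw [h14, abs_mul]; nlinarith
    have := r7 (by omega)
    have := r8 (by omega) (by omega)
    clear r7 r8
    refine ⟨(T * T) * (T * T), T * T, T, ?_, sz _ _⟩
    constructor <;> intro h <;> first | ring1 | (exfalso; omega)
  by_cases e1 : b = c
  · clear r7 r8
    refine ⟨T * T, T, T, ?_, sz _ _⟩
    constructor <;> intro h <;> first | ring1 | (exfalso; omega)
  by_cases e2 : b = -c
  · have := r7 e1
    clear r7 r8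
    refine ⟨T * T, T, -T, ?_, sy _ _⟩
    constructor <;> intro h <;> first | ring1 | (exfalso; omega)
  have := r7 e1
  have := r8 e1 e2
  clear r7 r8
  refine ⟨T * T, T, c, ?_, sy _ _⟩
  constructor <;> intro h <;> first | ring1 | (exfalso; omega)

/-- Besides `a = bc`, only `b = 2c`, `b = c²` and `a = 2b` can hold. The last forces `c = 2`, so it
is compatible with the family `(Tc, T, c)`; combined with either of the others it would give `a =
8`. -/
theorem exists_preservesTriple_of_mul {a b c : ℤ} (hbc : |c| ≤ |b|) (ha : 16 < |a|)
    (hc : 2 ≤ |c|) (h11 : a ≠ b * b) (h12 : a = b * c) :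
    ∃ x y z : ℤ, PreservesTriple a b c x y z ∧ (|a| < |x| ∨ |a| < |y| ∨ |a| < |z|) := by
  obtain ⟨T, hT, -⟩ := exists_large_int a
  have sy : ∀ x z : ℤ, |a| < |x| ∨ |a| < |T| ∨ |a| < |z| := fun _ _ => .inr (.inl hT)
  have sz : ∀ x y : ℤ, |a| < |x| ∨ |a| < |y| ∨ |a| < |T| := fun _ _ => .inr (.inr hT)
  have hbb : |b| * |b| = b * b := abs_mul_abs_self b
  have habs : |a| = |b| * |c| := by rw [h12, abs_mul]
  have hb5 : 5 ≤ |b| := by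
    by_contra! h
    nlinarith
  have hbb5 : 5 * |b| ≤ b * b := by nlinarith
  have p1 : 2 * |b| ≤ |a| := by nlinarith
  have p2 : |c| = |b| → 5 * |b| ≤ |a| := fun h => by rw [habs, h]; nlinarith
  have hbac : b ≠ a * c := fun h => by
    have h' : |b| = |a| * |c| := by rw [← abs_mul, ← h]
    nlinarith
  have hb0 : b ≠ 0 := by rintro rfl; simp at hb5
  have hc0 : c ≠ 0 := by rintro rfl; simp at hc
  have r7 : a = 2 * b → c = 2 := fun h => mul_left_cancel₀ hb0 (by rw [← h12, h, mul_comm])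
  have r8 : a ≠ c * c := fun h => h11 (by
    have hbc : b = c := mul_right_cancel₀ hc0 (by rw [← h12, h])
    rw [h, hbc])
  have ca := abs_choice a
  have cb := abs_choice b
  have cc := abs_choice c
  by_cases h10 : b = 2 * c
  · have : b ≠ c * c := fun h => by
      have : c = 2 := mul_right_cancel₀ hc0 (by rw [← h10, h])
      omega
    refine ⟨2 * (T * T), 2 * T, T, ?_, sz _ _⟩
    constructor <;> intro h <;> first | ring1 | (exfalso; omega)
  by_cases h14 : b = c * c
  · have : c ≠ 2 := by rintro rfl; omega
    refine ⟨T * (T * T), T * T, T, ?_, sz _ _⟩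
    constructor <;> intro h <;> first | ring1 | (exfalso; omega)
  refine ⟨T * c, T, c, ?_, sy _ _⟩
  constructor <;> intro h <;> first | ring1 | rw [r7 h, mul_comm] | (exfalso; omega)

/-- The family is `(T², y, T)` with `y` prescribed by the relation that ties `b` to `a` and `c`; for
`a = 2b`, the parameter is doubled to make `y` integral. If no relation ties `b`, it alone is moved.
-/
theorem exists_preservesTriple_of_c_sq {a b c : ℤ} (hab : |b| ≤ |a|) (hbc : |c| ≤ |b|)
    (ha : 16 < |a|) (h11 : a ≠ b * b) (h12 : a ≠ b * c) (h13 : a = c * c) :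
    ∃ x y z : ℤ, PreservesTriple a b c x y z ∧ (|a| < |x| ∨ |a| < |y| ∨ |a| < |z|) := by
  obtain ⟨T, hT, hT'⟩ := exists_large_int a
  have sy : ∀ x z : ℤ, |a| < |x| ∨ |a| < |T| ∨ |a| < |z| := fun _ _ => .inr (.inl hT)
  have sz : ∀ x y : ℤ, |a| < |x| ∨ |a| < |y| ∨ |a| < |T| := fun _ _ => .inr (.inr hT)
  have hcc : |c| * |c| = c * c := abs_mul_abs_self c
  have hbb : |b| * |b| = b * b := abs_mul_abs_self b
  have ha' := ha
  rw [h13, abs_of_nonneg (mul_self_nonneg c)] at ha'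
  have hc5 : 5 ≤ |c| := by
    by_contra! h
    nlinarith [abs_nonneg c]
  have hcc5 : 5 * |c| ≤ c * c := by nlinarith
  have hbb5 : 5 * |b| ≤ b * b := by nlinarith
  have hbac : b ≠ a * c := fun h => by
    have h' : |b| = |a| * |c| := by rw [← abs_mul, ← h]
    nlinarith
  have ca := abs_choice a
  have cb := abs_choice b
  have cc := abs_choice c
  clear ha'
  by_cases h5 : a = c - b
  · refine ⟨T * T, T - T * T, T, ?_, sz _ _⟩
    constructor <;> intro h <;> first | ring1 | (exfalso; omega)
  by_cases h6 : a = b - c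
  · refine ⟨T * T, T * T + T, T, ?_, sz _ _⟩
    constructor <;> intro h <;> first | ring1 | (exfalso; omega)
  by_cases h7 : a = 2 * b
  · refine ⟨4 * (T * T), 2 * (T * T), 2 * T, ?_, .inr (.inr hT')⟩
    constructor <;> intro h <;> first | ring1 | (exfalso; omega)
  by_cases h8 : a = b + c
  · refine ⟨T * T, T * T - T, T, ?_, sz _ _⟩
    constructor <;> intro h <;> first | ring1 | (exfalso; omega)
  by_cases h10 : b = 2 * c
  · refine ⟨T * T, 2 * T, T, ?_, sz _ _⟩
    constructor <;> intro h <;> first | ring1 | (exfalso; omega)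
  by_cases h14 : b = c * c
  · refine ⟨T * T, T * T, T, ?_, sz _ _⟩
    constructor <;> intro h <;> first | ring1 | (exfalso; omega)
  refine ⟨c * c, T, c, ?_, sy _ _⟩
  constructor <;> intro h <;> first | rfl | (exfalso; omega)

/-- With `(b, c)` replaced by `(T², T)`, a linear relation of `a` to `b` and `c` determines `x`.
Otherwise `a` occurs in no relation and is free. -/
theorem exists_preservesTriple_of_b_eq_c_sq {a b c : ℤ} (hab : |b| ≤ |a|) (ha : 16 < |a|)
    (hc : 2 ≤ |c|) (h11 : a ≠ b * b) (h12 : a ≠ b * c) (h13 : a ≠ c * c) (h14 : b = c * c) :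
    ∃ x y z : ℤ, PreservesTriple a b c x y z ∧ (|a| < |x| ∨ |a| < |y| ∨ |a| < |z|) := by
  obtain ⟨T, hT, -⟩ := exists_large_int a
  have sx : ∀ y z : ℤ, |a| < |T| ∨ |a| < |y| ∨ |a| < |z| := fun _ _ => .inl hT
  have sz : ∀ x y : ℤ, |a| < |x| ∨ |a| < |y| ∨ |a| < |T| := fun _ _ => .inr (.inr hT)
  have hcc : |c| * |c| = c * c := abs_mul_abs_self c
  have hbb : |b| * |b| = b * b := abs_mul_abs_self b
  have hb : |b| = |c| * |c| := by rw [h14, abs_mul]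
  have hcb : 2 * |c| ≤ |b| := by nlinarith
  have hbb5 : 4 * |b| ≤ b * b := by nlinarith
  have hbac : b ≠ a * c := fun h => by
    have h' : |b| = |a| * |c| := by rw [← abs_mul, ← h]
    nlinarith
  have hc0 : c ≠ 0 := by rintro rfl; simp at hc
  have r10 : b = 2 * c → c = 2 := fun h => mul_right_cancel₀ hc0 (by rw [← h14, h])
  have h9 : a ≠ 2 * c := fun h => by
    have h' : |a| = 2 * |c| := by rw [h, abs_mul, abs_two]
    nlinarith
  have ca := abs_choice a
  have cb := abs_choice b
  have cc := abs_choice c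
  by_cases h5 : a = c - b
  · refine ⟨T - T * T, T * T, T, ?_, sz _ _⟩
    constructor <;> intro h <;> first | ring1 | (exfalso; omega)
  by_cases h6 : a = b - c
  · refine ⟨T * T - T, T * T, T, ?_, sz _ _⟩
    constructor <;> intro h <;> first | ring1 | (exfalso; omega)
  by_cases h7 : a = 2 * b
  · refine ⟨2 * (T * T), T * T, T, ?_, sz _ _⟩
    constructor <;> intro h <;> first | ring1 | (exfalso; omega)
  by_cases h8 : a = b + c
  · refine ⟨T * T + T, T * T, T, ?_, sz _ _⟩
    constructor <;> intro h <;> first | ring1 | (exfalso; omega)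
  refine ⟨T, b, c, ?_, sx _ _⟩
  constructor <;> intro h <;> first | exact h | exact absurd h ‹_›

/-- Once every product relation is excluded, only homogeneous linear relations remain, and doubling
all entries preserves them. -/
theorem exists_preservesTriple {a b c : ℤ} (hab : |b| ≤ |a|) (hbc : |c| ≤ |b|) (ha : 16 < |a|) :
    ∃ x y z : ℤ, PreservesTriple a b c x y z ∧ (|a| < |x| ∨ |a| < |y| ∨ |a| < |z|) := by
  by_cases hc : |c| ≤ 1
  · exact exists_preservesTriple_of_abs_le_one hab ha hc
  replace hc : 2 ≤ |c| := by omega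
  by_cases h11 : a = b * b
  · exact exists_preservesTriple_of_b_sq hbc ha hc h11
  by_cases h12 : a = b * c
  · exact exists_preservesTriple_of_mul hbc ha hc h11 h12
  by_cases h13 : a = c * c
  · exact exists_preservesTriple_of_c_sq hab hbc ha h11 h12 h13
  by_cases h14 : b = c * c
  · exact exists_preservesTriple_of_b_eq_c_sq hab ha hc h11 h12 h13 h14
  have hbac : b ≠ a * c := fun h => by
    have h' : |b| = |a| * |c| := by rw [← abs_mul, ← h]
    nlinarith
  have hcbb : c ≠ b * b := fun h => by
    have h' : |c| = |b| * |b| := by rw [← abs_mul, ← h]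
    nlinarith
  refine ⟨2 * a, 2 * b, 2 * c, ?_, .inl (by rw [abs_mul, abs_two]; omega)⟩
  have cb := abs_choice b
  have cc := abs_choice c
  constructor <;> intro h <;> omega

open MuPAD (entry ListHom Respects Extendable supAbs supAbs_le_iff supAbs_nonneg SearchSucceeds)

/-! ### The Conjecture and the search -/

theorem entry_ofFn {n : ℕ} (x : Fin n → ℤ) (i : Fin n) :
    entry (List.ofFn x) ((i : ℕ) + 1 : ℤ) = x i := by
  simp [entry]

theorem listHom_ofFn {n : ℕ} (x y : Fin n → ℤ) :
    ListHom (List.ofFn x) (List.ofFn y) ↔ Preserves x y := by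
  constructor
  · intro h i j k
    have h' := h (i + 1) (j + 1) (k + 1) (by omega) (by simp) (by omega) (by simp)
      (by omega) (by simp)
    simpa only [Respects, entry_ofFn] using h'
  · intro h i j k hi hi' hj hj' hk hk'
    rw [List.length_ofFn] at hi' hj' hk'
    have key : ∀ i : ℤ, 1 ≤ i → i ≤ n → ∃ j : Fin n, i = (j : ℕ) + 1 := fun i h1 h2 =>
      ⟨⟨(i - 1).toNat, by omega⟩, by simp; omega⟩
    obtain ⟨i, rfl⟩ := key i hi hi'
    obtain ⟨j, rfl⟩ := key j hj hj'
    obtain ⟨k, rfl⟩ := key k hk hk'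
    simpa only [Respects, entry_ofFn] using h i j k

theorem extendable_ofFn {n : ℕ} (x : Fin n → ℤ) :
    Extendable (List.ofFn x) ↔
      ∃ y, supAbs (List.ofFn x) < supAbs (List.ofFn y) ∧ Preserves x y := by
  constructor
  · rintro ⟨l, hlen, hlt, hhom⟩
    rw [List.length_ofFn] at hlen
    subst hlen
    refine ⟨l.get, ?_, ?_⟩
    · rwa [List.ofFn_get]
    · rwa [← listHom_ofFn, List.ofFn_get]
  · rintro ⟨y, hlt, hhom⟩
    exact ⟨List.ofFn y, by simp, hlt, (listHom_ofFn x y).2 hhom⟩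

theorem supAbs_ofFn_le_iff {n : ℕ} {x : Fin n → ℤ} {b : ℤ} (hb : 0 ≤ b) :
    supAbs (List.ofFn x) ≤ b ↔ ∀ i, |x i| ≤ b := by
  rw [supAbs_le_iff hb]
  simp

theorem lt_supAbs_ofFn_iff {n : ℕ} {x : Fin n → ℤ} {b : ℤ} (hb : 0 ≤ b) :
    b < supAbs (List.ofFn x) ↔ ∃ i, b < |x i| := by
  rw [← not_le, supAbs_ofFn_le_iff hb]
  simp

theorem abs_le_supAbs_ofFn {n : ℕ} (x : Fin n → ℤ) (i : Fin n) : |x i| ≤ supAbs (List.ofFn x) :=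
  (supAbs_ofFn_le_iff (supAbs_nonneg _)).1 le_rfl i

theorem searchSucceeds_iff (n : ℕ) :
    SearchSucceeds n ↔ ∀ x : Fin n → ℤ, 2 ^ 2 ^ (n - 1) < supAbs (List.ofFn x) →
      supAbs (List.ofFn x) ≤ 2 ^ 2 ^ n →
        ∃ y, supAbs (List.ofFn x) < supAbs (List.ofFn y) ∧ Preserves x y := by
  constructor
  · intro h x h1 h2
    exact (extendable_ofFn x).1 (h _ (by simp) h1 h2)
  · intro h l hl h1 h2
    subst hl
    have hl := List.ofFn_get l
    have := (extendable_ofFn _).2 (h l.get (by rwa [hl]) (by rwa [hl]))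
    rwa [hl] at this

theorem ConjectureFor.searchSucceeds {n : ℕ} (h : ConjectureFor n) : SearchSucceeds n := by
  rw [searchSucceeds_iff]
  intro x h1 h2
  by_contra! hx
  obtain ⟨i, hi⟩ := (lt_supAbs_ofFn_iff (by positivity)).1 h1
  -- The system consists of the additive and multiplicative equations of `x`. The equations `x_i =
  -- 1` are left out because the search does not test them; even so, all solutions lie in the box
  -- bounded by the maximum of `x`.
  refine (h {e | e.Holds x ∧ ∀ i, e ≠ .one i} ?_ x (fun e he => he.1) i).not_gt hi
  refine (Set.finite_Icc (fun _ : Fin n => -supAbs (List.ofFn x))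
    (fun _ : Fin n => supAbs (List.ofFn x))).subset fun y hy => ?_
  have hy' : supAbs (List.ofFn y) ≤ supAbs (List.ofFn x) := by
    by_contra! hlt
    exact hx y hlt fun i j k =>
      ⟨fun e => hy (.add i j k) ⟨e, by simp⟩, fun e => hy (.mul i j k) ⟨e, by simp⟩⟩
  rw [supAbs_ofFn_le_iff (supAbs_nonneg _)] at hy'
  exact ⟨fun i => (abs_le.1 (hy' i)).1, fun i => (abs_le.1 (hy' i)).2⟩

/-- The equation with the same unknowns among more unknowns. -/
def Equation.castSucc {n : ℕ} : Equation n → Equation (n + 1)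
  | .one i => .one i.castSucc
  | .add i j k => .add i.castSucc j.castSucc k.castSucc
  | .mul i j k => .mul i.castSucc j.castSucc k.castSucc

theorem Equation.holds_castSucc {n : ℕ} (e : Equation n) (x : Fin (n + 1) → ℤ) :
    e.castSucc.Holds x ↔ e.Holds (Fin.init x) := by
  cases e <;> rfl

/-- A new unknown equal to the square of an entry above `2^(2^(n-1))` exceeds `2^(2^n)`, and it is
determined by the old unknowns, so finiteness persists. -/
theorem ConjectureFor.of_succ {n : ℕ} (hn : 1 ≤ n) (h : ConjectureFor (n + 1)) :
    ConjectureFor n := by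
  intro S hS x hx i
  by_contra! hi
  let T : Set (Equation (n + 1)) :=
    Equation.castSucc '' S ∪ {.mul i.castSucc i.castSucc (Fin.last n)}
  have hT : ∀ y, y ∈ solutions T ↔
      Fin.init y ∈ solutions S ∧ y (Fin.last n) = Fin.init y i * Fin.init y i := by
    intro y
    simp only [T, solutions, Set.mem_ofPred_eq, Set.mem_union, Set.mem_image,
      Set.mem_singleton_iff, or_imp, forall_and, forall_exists_index, and_imp,
      forall_apply_eq_imp_iff₂, Equation.holds_castSucc, forall_eq]
    exact and_congr_right fun _ => eq_comm
  have hfin : (solutions T).Finite := by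
    refine (hS.image fun x => (Fin.snoc x (x i * x i) : Fin (n + 1) → ℤ)).subset fun y hy => ?_
    obtain ⟨h1, h2⟩ := (hT y).1 hy
    refine ⟨Fin.init y, h1, ?_⟩
    simp only [← h2, Fin.snoc_init_self]
  have hsol : (Fin.snoc x (x i * x i) : Fin (n + 1) → ℤ) ∈ solutions T := by
    rw [hT, Fin.init_snoc, Fin.snoc_last]
    exact ⟨hx, rfl⟩
  have := h T hfin _ hsol (Fin.last n)
  rw [Fin.snoc_last, abs_mul, Nat.add_sub_cancel] at this
  have hpow : (2 : ℤ) ^ 2 ^ n = 2 ^ 2 ^ (n - 1) * 2 ^ 2 ^ (n - 1) := by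
    rw [← pow_add, ← two_mul, ← pow_succ', Nat.sub_add_cancel hn]
  rw [hpow] at this
  exact this.not_gt (mul_lt_mul'' hi hi (by positivity) (by positivity))

theorem ConjectureFor.of_le {m n : ℕ} (hm : 1 ≤ m) (hmn : m ≤ n) (h : ConjectureFor n) :
    ConjectureFor m := by
  induction n, hmn using Nat.le_induction with
  | base => exact h
  | succ n hn ih => exact ih (h.of_succ (hm.trans hn))

theorem exists_not_searchSucceeds {n : ℕ} (hn : 1 ≤ n) (h : ¬ ConjectureFor n) :
    ∃ N, n ≤ N ∧ ¬ SearchSucceeds N := by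
  simp only [ConjectureFor, not_forall, not_le] at h
  obtain ⟨S, hS, x₀, hx₀, i₀, hi₀⟩ := h
  obtain ⟨x, hx, hmax⟩ := Set.exists_max_image (solutions S) (fun x => supAbs (List.ofFn x)) hS
    ⟨x₀, hx₀⟩
  have hlt : 2 ^ 2 ^ (n - 1) < supAbs (List.ofFn x) :=
    hi₀.trans_le ((abs_le_supAbs_ofFn x₀ i₀).trans (hmax x₀ hx₀))
  set M := supAbs (List.ofFn x) with hM
  have hM0 : 1 ≤ M := (one_le_pow₀ (by norm_num)).trans hlt.le
  -- `N` is the least length from `n` on whose upper bound covers `M`. If it is `n` itself, the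
  -- lower bound is `hlt`; otherwise it is minimality.
  obtain ⟨N, hnN, hN1, hN2⟩ : ∃ N, n ≤ N ∧ 2 ^ 2 ^ (N - 1) < M ∧ M ≤ 2 ^ 2 ^ N := by
    classical
    have hex : ∃ k, n ≤ k ∧ M ≤ 2 ^ 2 ^ k := by
      refine ⟨max n M.toNat, le_max_left _ _, ?_⟩
      have h1 : M.toNat < 2 ^ 2 ^ max n M.toNat :=
        ((le_max_right n _).trans_lt Nat.lt_two_pow_self).trans Nat.lt_two_pow_self
      zify at h1
      omega
    refine ⟨Nat.find hex, (Nat.find_spec hex).1, ?_, (Nat.find_spec hex).2⟩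
    rcases (Nat.find_spec hex).1.eq_or_lt with he | hlt'
    · rwa [← he]
    · by_contra! hle
      exact Nat.find_min hex (m := Nat.find hex - 1) (by omega) ⟨by omega, hle⟩
  refine ⟨N, hnN, fun hN => ?_⟩
  rw [searchSucceeds_iff] at hN
  let x' : Fin N → ℤ := fun i => if h : (i : ℕ) < n then x ⟨i, h⟩ else 1
  have hx' : ∀ i : Fin n, x' (Fin.castLE hnN i) = x i := fun i => by simp [x']
  have hM' : supAbs (List.ofFn x') = M := by
    refine le_antisymm ((supAbs_ofFn_le_iff (by omega)).2 fun i => ?_)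
      ((supAbs_ofFn_le_iff (supAbs_nonneg _)).2 fun i => ?_)
    · by_cases h : (i : ℕ) < n
      · simpa [x', h] using abs_le_supAbs_ofFn x ⟨i, h⟩
      · simpa [x', h] using hM0
    · rw [← hx' i]
      exact abs_le_supAbs_ofFn x' _
  obtain ⟨y', hy', hpres⟩ := hN x' (by rwa [hM']) (by rwa [hM'])
  rw [hM'] at hy'
  have hidem : ∀ i, x' i = 1 → y' i = 0 ∨ y' i = 1 := fun i hi =>
    eq_zero_or_one_of_mul_eq_right ((hpres i i i).2 (by rw [hi, one_mul]))
  obtain ⟨j, hj⟩ := (lt_supAbs_ofFn_iff (by omega)).1 hy'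
  -- An entry `1` gives an idempotent. Were it `0`, the equations `1 * x_j = x_j` would annihilate
  -- the whole tuple `y'`, which has a large entry. So the equations `x_i = 1` of `S` are recovered
  -- without being tested.
  have hone : ∀ i, x' i = 1 → y' i = 1 := fun i hi => by
    refine (hidem i hi).resolve_left fun h0 => ?_
    have := (hpres i j j).2 (by rw [hi, one_mul])
    rw [h0, zero_mul] at this
    rw [← this, abs_zero] at hj
    omega
  have hsol : (fun i => y' (Fin.castLE hnN i)) ∈ solutions S := by
    intro e he
    have hxe := hx e he
    cases e with
    | one i => exact hone _ (by rw [hx']; exact hxe)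
    | add i j k => exact (hpres _ _ _).1 (by simpa only [hx', Equation.Holds] using hxe)
    | mul i j k => exact (hpres _ _ _).2 (by simpa only [hx', Equation.Holds] using hxe)
  by_cases h : (j : ℕ) < n
  · have := (abs_le_supAbs_ofFn _ ⟨j, h⟩).trans (hmax _ hsol)
    exact this.not_gt hj
  · rw [hone j (by simp [x', h]), abs_one] at hj
    omega

/-! ### Lengths two and three -/

/-- Maxima and equations are invariant under permutations of the positions, so the entries may be
sorted by decreasing absolute value. -/
theorem searchSucceeds_of_antitone {n : ℕ}
    (h : ∀ x : Fin n → ℤ, Antitone (fun i => |x i|) → 2 ^ 2 ^ (n - 1) < supAbs (List.ofFn x) →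
      ∃ y, supAbs (List.ofFn x) < supAbs (List.ofFn y) ∧ Preserves x y) :
    SearchSucceeds n := by
  rw [searchSucceeds_iff]
  intro x h1 _
  have hperm : ∀ (σ : Equiv.Perm (Fin n)) (x : Fin n → ℤ),
      supAbs (List.ofFn (x ∘ σ)) = supAbs (List.ofFn x) := by
    intro σ x
    refine le_antisymm ((supAbs_ofFn_le_iff (supAbs_nonneg _)).2 fun i => abs_le_supAbs_ofFn x _)
      ((supAbs_ofFn_le_iff (supAbs_nonneg _)).2 fun i => ?_)
    simpa using abs_le_supAbs_ofFn (x ∘ σ) (σ.symm i)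
  let σ := Tuple.sort fun i => -|x i|
  have hσ : Antitone fun i => |(x ∘ σ) i| := fun i j hij =>
    neg_le_neg_iff.1 (Tuple.monotone_sort (fun i => -|x i|) hij)
  obtain ⟨y, hy, hpres⟩ := h (x ∘ σ) hσ (by rwa [hperm])
  refine ⟨y ∘ σ.symm, by rwa [hperm, ← hperm σ], fun i j k => ?_⟩
  simpa using hpres (σ.symm i) (σ.symm j) (σ.symm k)

theorem supAbs_ofFn_of_antitone {n : ℕ} {x : Fin (n + 1) → ℤ} (hx : Antitone fun i => |x i|) :
    supAbs (List.ofFn x) = |x 0| :=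
  le_antisymm ((supAbs_ofFn_le_iff (abs_nonneg _)).2 fun i => hx (Fin.zero_le i))
    (abs_le_supAbs_ofFn x 0)

theorem searchSucceeds_two : SearchSucceeds 2 := by
  refine searchSucceeds_of_antitone fun x hx h1 => ?_
  rw [supAbs_ofFn_of_antitone hx] at h1 ⊢
  obtain ⟨y, z, hpres, hlt⟩ := exists_preserves_pair (a := x 0) (b := x 1)
    (hx (Fin.zero_le 1)) (by simpa using h1)
  refine ⟨![y, z], (lt_supAbs_ofFn_iff (abs_nonneg _)).2 ?_, ?_⟩
  · rcases hlt with hlt | hlt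
    exacts [⟨0, hlt⟩, ⟨1, hlt⟩]
  · rwa [show x = ![x 0, x 1] by ext i; fin_cases i <;> rfl]

theorem searchSucceeds_three : SearchSucceeds 3 := by
  refine searchSucceeds_of_antitone fun x hx h1 => ?_
  rw [supAbs_ofFn_of_antitone hx] at h1 ⊢
  have h01 : |x 1| ≤ |x 0| := hx (Fin.zero_le 1)
  have h12 : |x 2| ≤ |x 1| := hx (by decide : (1 : Fin 3) ≤ 2)
  have h1 : 16 < |x 0| := by norm_num at h1; exact h1
  obtain ⟨y, z, w, hpres, hlt⟩ := exists_preservesTriple h01 h12 h1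
  refine ⟨![y, z, w], (lt_supAbs_ofFn_iff (abs_nonneg _)).2 ?_, ?_⟩
  · rcases hlt with hlt | hlt | hlt
    exacts [⟨0, hlt⟩, ⟨1, hlt⟩, ⟨2, hlt⟩]
  · rw [show x = ![x 0, x 1, x 2] by ext i; fin_cases i <;> rfl]
    exact hpres.preserves h01 h12 h1

/-! ### The integers that are displayed -/

namespace MuPAD

/-- The list `2, 3, …, n + 1`. -/
def displayed (n : ℕ) : List ℤ := (List.range n).map fun r : ℕ => (r : ℤ) + 2

theorem displayed_succ (n : ℕ) : displayed (n + 1) = displayed n ++ [((n + 2 : ℕ) : ℤ)] := by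
  simp [displayed, List.range_succ]

theorem getElem?_displayed {n r : ℕ} {z : ℤ} :
    (displayed n)[r]? = some z ↔ r < n ∧ z = (r : ℤ) + 2 := by
  by_cases h : r < n <;> simp [displayed, h, eq_comm]

theorem start_code (s : Store) : ∃ d, Reaches (start code s) d ∧ AtHead (firstTuple 2) [] d := by
  refine ⟨⟨[mainLoop], s.setList .X [-5, -5], []⟩, Reaches.of_step ?_, _, _, rfl, ?_, rfl⟩
  · simp [start, code_eq, State.step, ListExpr.eval]
  · simp [firstTuple]

theorem reaches_firstTuple (s : Store) (n : ℕ) (h : ∀ m < n, SearchSucceeds (m + 2)) :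
    ∃ d, Reaches (start code s) d ∧ AtHead (firstTuple (n + 2)) (displayed n) d := by
  induction n with
  | zero => exact start_code s
  | succ n ih =>
    obtain ⟨d, hd, hd'⟩ := ih fun m hm => h m (by omega)
    obtain ⟨e, he, he'⟩ := hd'.of_searchSucceeds (by omega) (h n (by omega))
    exact ⟨e, hd.trans he, by rwa [displayed_succ]⟩

theorem State.after_isSome_of_le {c d : State} {j k : ℕ} (h : c.after k = some d) (hjk : j ≤ k) :
    ∃ e, c.after j = some e := by
  obtain ⟨e, he, -⟩ := State.after_of_le h hjk
  exact ⟨e, he⟩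

theorem State.getElem?_of_after {c d : State} {k r : ℕ} {z : ℤ} (h : c.after k = some d)
    (hz : (integersIn c.output)[r]? = some z) : (integersIn d.output)[r]? = some z := by
  obtain ⟨t, ht⟩ := State.after_integersIn h
  rw [← ht, List.getElem?_append_left, hz]
  exact (List.getElem?_eq_some_iff.1 hz).1

theorem neverTerminates_of_forall_searchSucceeds (s : Store) (h : ∀ n, 2 ≤ n → SearchSucceeds n) :
    NeverTerminates code s ∧ ∀ (r : ℕ) (z : ℤ), DisplaysInteger code s r z ↔ z = (r : ℤ) + 2 := by
  have hreach := fun n => reaches_firstTuple s n fun m _ => h (m + 2) (by omega)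
  have hlarge : ∀ k, ∃ j d n, k ≤ j ∧ (start code s).after j = some d ∧
      AtHead (firstTuple (n + 2)) (displayed n) d := by
    intro k
    obtain ⟨c, ⟨i, hi⟩, hc⟩ := hreach 0
    obtain ⟨j, d, hj, hd, n, hn⟩ := State.after_of_recurrent
      (P := fun d => ∃ n, AtHead (firstTuple (n + 2)) (displayed n) d) (fun c ⟨n, hc⟩ => by
        obtain ⟨d, ⟨k, hk⟩, hd⟩ := hc.of_searchSucceeds (by omega) (h (n + 2) (by omega))
        rw [← displayed_succ] at hd
        -- Between two such states at least one step passes, since one more integer has been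
        -- displayed.
        obtain _ | k := k
        · obtain ⟨s1, o1, rfl, -, h1⟩ := hc
          obtain ⟨s2, o2, h2, -, h3⟩ := hd
          simp only [State.after, Option.some.injEq] at hk
          rw [← hk] at h2
          simp only [State.mk.injEq] at h2
          rw [← h2.2.2, h1] at h3
          simpa [displayed] using congrArg List.length h3
        · exact ⟨k, d, hk, n + 1, hd⟩) ⟨0, hc⟩ k
    exact ⟨i + j, d, n, by omega, by rw [State.after_add, hi]; exact hd, hn⟩
  refine ⟨fun k => ?_, fun r z => ⟨?_, ?_⟩⟩
  · obtain ⟨j, d, n, hj, hd, -⟩ := hlarge k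
    exact State.after_isSome_of_le hd hj
  · rintro ⟨k, c, hc, hz⟩
    obtain ⟨j, d, n, hj, hd, s', o, rfl, -, hn⟩ := hlarge k
    obtain ⟨e, he, hed⟩ := State.after_of_le hd hj
    obtain rfl : c = e := Option.some.inj (hc.symm.trans he)
    have := State.getElem?_of_after hed hz
    rw [hn, getElem?_displayed] at this
    exact this.2
  · rintro rfl
    obtain ⟨d, ⟨k, hk⟩, s', o, rfl, -, hn⟩ := hreach (r + 1)
    exact ⟨k, _, hk, by rw [hn, getElem?_displayed]; exact ⟨by omega, rfl⟩⟩

theorem neverTerminates_of_least_not_searchSucceeds (s : Store) {n : ℕ}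
    (hn : ¬ SearchSucceeds (n + 2))
    (h : ∀ m < n, SearchSucceeds (m + 2)) :
    NeverTerminates code s ∧ ∀ (r : ℕ) (z : ℤ), DisplaysInteger code s r z ↔
      r < n ∧ z = (r : ℤ) + 2 := by
  obtain ⟨c, hc, hc'⟩ := reaches_firstTuple s n h
  obtain ⟨d, hd, hd'⟩ := hc'.of_not_searchSucceeds (by omega) hn
  obtain ⟨i, hi⟩ := hc.trans hd
  have hlarge : ∀ k, ∃ j e, k ≤ j ∧ (start code s).after j = some e ∧ Stuck (displayed n) e := by
    intro k
    obtain ⟨j, e, hj, he, he'⟩ := State.after_of_recurrent Stuck.recurrent hd' k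
    exact ⟨i + j, e, by omega, by rw [State.after_add, hi]; exact he, he'⟩
  refine ⟨fun k => ?_, fun r z => ⟨?_, fun hz => ?_⟩⟩
  · obtain ⟨j, e, hj, he, -⟩ := hlarge k
    exact State.after_isSome_of_le he hj
  · rintro ⟨k, c, hc, hz⟩
    obtain ⟨j, e, hj, he, he', -⟩ := hlarge k
    obtain ⟨f, hf, hfe⟩ := State.after_of_le he hj
    obtain rfl : c = f := Option.some.inj (hc.symm.trans hf)
    have := State.getElem?_of_after hfe hz
    rwa [he', getElem?_displayed] at this
  · exact ⟨i, d, hi, by rw [hd'.1, getElem?_displayed]; exact hz⟩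

end MuPAD

/-- The code, started with arbitrary values of its variables, never terminates; the integers
that it displays are `2, 3, 4, …` if the Conjecture is true; if the Conjecture is false, they are
`2, …, n - 1` for some `n ≥ 4` such that the Conjecture fails for all `m ≥ n`. -/
theorem theorem2 (s : MuPAD.Store) :
    MuPAD.NeverTerminates MuPAD.code s ∧
    (Conjecture → ∀ (r : ℕ) (z : ℤ),
      MuPAD.DisplaysInteger MuPAD.code s r z ↔ z = (r : ℤ) + 2) ∧
    (¬ Conjecture → ∃ n : ℕ, 4 ≤ n ∧
      (∀ (r : ℕ) (z : ℤ),
        MuPAD.DisplaysInteger MuPAD.code s r z ↔ (z = (r : ℤ) + 2 ∧ z ≤ (n : ℤ) - 1)) ∧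
      ∀ m : ℕ, n ≤ m → ¬ ConjectureFor m) := by
  by_cases h : ∀ n, 2 ≤ n → SearchSucceeds n
  · obtain ⟨h1, h2⟩ := MuPAD.neverTerminates_of_forall_searchSucceeds s h
    refine ⟨h1, fun _ => h2, fun hC => ?_⟩
    simp only [Conjecture, not_forall] at hC
    obtain ⟨n, hn, hC⟩ := hC
    -- Passing to `n + 1` ensures `N ≥ 2`; the program does not treat length `1`.
    obtain ⟨N, hN, hN'⟩ := exists_not_searchSucceeds (n := n + 1) (by omega)
      fun h' => hC (h'.of_succ hn)
    exact absurd (h N (by omega)) hN'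
  · have hex : ∃ n, ¬ SearchSucceeds (n + 2) := by
      push Not at h
      obtain ⟨n, hn, h⟩ := h
      exact ⟨n - 2, by rwa [Nat.sub_add_cancel hn]⟩
    classical
    obtain ⟨n, hn, hmin⟩ : ∃ n, ¬ SearchSucceeds (n + 2) ∧ ∀ m < n, SearchSucceeds (m + 2) :=
      ⟨Nat.find hex, Nat.find_spec hex, fun m hm => not_not.1 (Nat.find_min hex hm)⟩
    have hn2 : 2 ≤ n := by
      by_contra! hlt
      obtain rfl | rfl : n = 0 ∨ n = 1 := by omega
      exacts [hn searchSucceeds_two, hn searchSucceeds_three]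
    -- The Conjecture for some `m ≥ n + 2` would descend to `n + 2` and make the search of that
    -- length succeed.
    have hfail : ∀ m, n + 2 ≤ m → ¬ ConjectureFor m := fun m hm h' =>
      hn (h'.of_le (by omega) hm).searchSucceeds
    obtain ⟨h1, h2⟩ := MuPAD.neverTerminates_of_least_not_searchSucceeds s hn hmin
    refine ⟨h1, fun hC => absurd (hC (n + 2) (by omega)) (hfail _ le_rfl), fun _ =>
      ⟨n + 2, by omega, fun r z => ?_, hfail⟩⟩
    rw [h2]
    push_cast
    constructor
    · rintro ⟨hr, rfl⟩
      exact ⟨rfl, by omega⟩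
    · rintro ⟨rfl, hr⟩
      exact ⟨by omega, rfl⟩
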